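/- **Setting.** Let $U,V:\mathbb R\to\mathbb R$ be potentials, $\sigma_N\ge 0$ diffusion coefficients, and for each $N$ let $D_N\subseteq\mathbb R^N$ be a state space for the $N$-particle system (for ordered particles $D_N=\{x_1<\dots<x_N\}$; $D_N=\mathbb R^N$ if particles may cross). A *solution of the $N$-particle system* consists of a filtered probability space, $N$ independent real Brownian motions $B^1,\dots,B^N$ relative to its filtration, and an adapted process $\mathbf X=(X^1,\dots,X^N)$ with almost surely continuous paths such that $\mathbf X_t\in D_N$ almost surely for every $t\ge0$ and, almost surely, for all $i$ and $t\geq 0$, the drift is integrable on $[0,t]$ and $$X^i_t=X^i_0+\sqrt{2\sigma_N}\,B^i_t-\int_0^t U'(X^i_s)\,ds-\int_0^t\frac1N\sum_{j\ne i}V'(X^i_s-X^j_s)\,ds .$$ Write $\mathcal W_2(\mu,\nu)=\left(\inf_\Gamma\int|x-y|^2\,d\Gamma\right)^{1/2}$, the infimum being over all couplings $\Gamma$ of $\mu$ and $\nu$, for the $L^2$ Wasserstein distance of probability measures on a Euclidean space. **Theorem 5.1.** For every $N\ge1$ let $(X^1_t,\dots,X^N_t)_{t\ge0}$ be a solution of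 the $N$-particle system (for instance a strong one), let $\mu^N_t=\frac1N\sum_{i=1}^N\delta_{X^i_t}$ be its empirical measure, and let $(\bar\rho_t)_{t\ge0}$ be probability measures on $\mathbb R$. Assume: 1. (Weak propagation of chaos) $\mathcal W_2(\mu^N_0,\bar\rho_0)\to0$ in probability, and for every $t\ge0$, $\mu^N_t\to\bar\rho_t$ weakly in probability as $N\to\infty$, i.e. $\int f\,d\mu^N_t\to\int f\,d\bar\rho_t$ in probability for every bounded continuous $f$. 2. (Bounded moments) There is $C_0\ge0$ such that $\mathbb E\left(\frac1N\sum_{i=1}^N|X^i_t|^4\right)\le C_0$ for all $N\ge1$ and $t\ge0$. 3. (Long time convergence) There is $\lambda>0$ such that for every $N\ge1$ and any two solutions of the $N$-particle system, possibly on different filtered probability spaces and with arbitrary initial laws, the laws $\rho^{1,N}_t,\rho^{2,N}_t$ on $\mathbb R^N$ of these solutions at time $t$ satisfy $\mathcal W_2(\rho^{1,N}_t,\rho^{2,N}_t)\le e^{-\lambda t}\,\mathcal W_2(\rho^{1,N}_0,\rho^{2,N}_0)$ for all $t\ge0$. 4. (Continuity at $0$) For every $\epsilon>0$ there is $\delta>0$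 such that $\mathbb E\left(\frac1N\sum_{i=1}^N|X^i_t-X^i_0|^2\right)\le\epsilon$ for all $0\le t<\delta$ and all $N\ge1$. Then strong propagation of chaos holds uniformly in time: $$\forall\epsilon>0,\ \exists N\ge0,\ \forall t\ge0,\ \forall n\ge N,\qquad \mathbb E\left(\mathcal W_2(\mu^n_t,\bar\rho_t)\right)<\epsilon .$$ -/

import Mathlib

open MeasureTheory ProbabilityTheory Filter Topology
open scoped NNReal ENNReal BoundedContinuousFunction

universe u

noncomputable section

namespace ParticleChaos

/-- The `L²` Wasserstein distance of two measures: the square root of the infimum, over all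
couplings `Γ`, of `∫ |x - y|² dΓ`. It takes its values in `[0, ∞]`. -/
def W2 {E : Type*} [MeasurableSpace E] [PseudoEMetricSpace E] (μ ν : Measure E) : ℝ≥0∞ :=
  (⨅ (Γ : Measure (E × E)) (_ : Γ.map Prod.fst = μ ∧ Γ.map Prod.snd = ν),
    ∫⁻ z, edist z.1 z.2 ^ 2 ∂Γ) ^ (1 / 2 : ℝ)

/-- The empirical measure `(1/N) ∑ i, δ_{x i}` of a configuration of `N` points of the line. -/
def empiricalMeasure {N : ℕ} (x : EuclideanSpace ℝ (Fin N)) : Measure ℝ :=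
  (N : ℝ≥0∞)⁻¹ • ∑ i, Measure.dirac (x i)

/-- The drift `-U'(x i) - (1/N) ∑_{j ≠ i} V'(x i - x j)` acting on the `i`-th particle. -/
def drift {N : ℕ} (U V : ℝ → ℝ) (x : EuclideanSpace ℝ (Fin N)) (i : Fin N) : ℝ :=
  -deriv U (x i) - (1 / (N : ℝ)) * ∑ j ∈ Finset.univ.erase i, deriv V (x i - x j)

/-- `B` is a family of `N` independent standard real Brownian motions relative to the
filtration `F`: it is adapted, and its increments after time `s` are independent of `F s`. -/
structure IsBrownianFamily {Ω : Type*} {mΩ : MeasurableSpace Ω} {N : ℕ} (P : Measure Ω)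
    (F : Filtration ℝ≥0 mΩ) (B : Fin N → ℝ≥0 → Ω → ℝ) : Prop where
  brownian : ∀ i, IsBrownianReal (B i) P
  indep : iIndepFun (fun i ω t => B i t ω) P
  adapted : ∀ i, Adapted F (B i)
  indep_increments : ∀ s t, s ≤ t →
    Indep (MeasurableSpace.comap (fun ω i => B i t ω - B i s ω) MeasurableSpace.pi) (F s) P

/-- `X` solves, on the filtered probability space `(Ω, F, P)` and driven by the Brownian motions
`B`, the `N`-particle system
`dX^i = √(2σ) dB^i - U'(X^i) dt - (1/N) ∑_{j ≠ i} V'(X^i - X^j) dt`,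
and its law at each time is carried by the state space `D ⊆ ℝ^N`. The state space is the set of
all `x` with `x 1 < ... < x N` for ordered particles in singular repulsive interaction, and the
whole of `ℝ^N` if particles may cross. Since the noise is additive, the equation is an identity
between paths. A strong solution is such a solution. -/
structure IsSolution {Ω : Type*} {mΩ : MeasurableSpace Ω} {N : ℕ} (U V : ℝ → ℝ) (σ : ℝ≥0)
    (D : Set (EuclideanSpace ℝ (Fin N))) (P : Measure Ω) (F : Filtration ℝ≥0 mΩ)
    (B : Fin N → ℝ≥0 → Ω → ℝ) (X : ℝ≥0 → Ω → EuclideanSpace ℝ (Fin N)) : Prop where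
  isBrownianFamily : IsBrownianFamily P F B
  adapted : Adapted F X
  continuous_paths : ∀ᵐ ω ∂P, Continuous fun t => X t ω
  mem_state : ∀ t, ∀ᵐ ω ∂P, X t ω ∈ D
  integrable_drift : ∀ᵐ ω ∂P, ∀ (i : Fin N) (t : ℝ≥0),
    IntervalIntegrable (fun s : ℝ => drift U V (X s.toNNReal ω) i) volume 0 t
  equation : ∀ᵐ ω ∂P, ∀ (i : Fin N) (t : ℝ≥0),
    X t ω i = X 0 ω i + √(2 * (σ : ℝ)) * B i t ω
      + ∫ s in (0 : ℝ)..t, drift U V (X s.toNNReal ω) i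

/-- Weak propagation of chaos: the initial empirical measures converge to `ρ 0` in `W2`, in
probability, and for every `t` the empirical measures at time `t` converge to the deterministic
measure `ρ t` weakly, in probability. For each `N`, the `N`-particle system may live on its own
probability space. -/
def WeakPropagationOfChaos {Ω : ℕ → Type*} [∀ N, MeasurableSpace (Ω N)]
    (P : ∀ N, Measure (Ω N)) (X : ∀ N, ℝ≥0 → Ω N → EuclideanSpace ℝ (Fin N))
    (ρ : ℝ≥0 → ProbabilityMeasure ℝ) : Prop :=
  (∀ ε : ℝ, 0 < ε → Tendsto
    (fun N => P N {ω | ENNReal.ofReal ε ≤ W2 (empiricalMeasure (X N 0 ω)) (ρ 0 : Measure ℝ)})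
    atTop (𝓝 0)) ∧
  ∀ t : ℝ≥0, ∀ f : ℝ →ᵇ ℝ, ∀ ε : ℝ, 0 < ε → Tendsto
    (fun N => P N {ω | ε ≤ |∫ x, f x ∂(empiricalMeasure (X N t ω)) - ∫ x, f x ∂(ρ t : Measure ℝ)|})
    atTop (𝓝 0)

/-- The fourth moments `E ((1/N) ∑ i, |X^i_t|⁴)` are bounded uniformly in `N ≥ 1` and `t ≥ 0`. -/
def BoundedFourthMoments {Ω : ℕ → Type*} [∀ N, MeasurableSpace (Ω N)]
    (P : ∀ N, Measure (Ω N)) (X : ∀ N, ℝ≥0 → Ω N → EuclideanSpace ℝ (Fin N)) : Prop :=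
  ∃ C₀ : ℝ, 0 ≤ C₀ ∧ ∀ N : ℕ, 1 ≤ N → ∀ t : ℝ≥0,
    ∫⁻ ω, ENNReal.ofReal ((1 / (N : ℝ)) * ∑ i, |X N t ω i| ^ 4) ∂(P N) ≤ ENNReal.ofReal C₀

/-- Long time convergence: there is a rate `κ > 0`, independent of `N`, such that the laws of any
two solutions of the `N`-particle system, on arbitrary filtered probability spaces and with
arbitrary initial laws, get closer at the rate `exp (-κ t)` in the `W2` distance of `ℝ^N`
with its Euclidean norm. -/
def LongTimeConvergence (U V : ℝ → ℝ) (σ : ℕ → ℝ≥0)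
    (D : ∀ N : ℕ, Set (EuclideanSpace ℝ (Fin N))) : Prop :=
  ∃ κ : ℝ, 0 < κ ∧ ∀ N : ℕ, 1 ≤ N →
    ∀ (Ω₁ Ω₂ : Type u) (m₁ : MeasurableSpace Ω₁) (m₂ : MeasurableSpace Ω₂)
      (P₁ : Measure Ω₁) (P₂ : Measure Ω₂) (_ : IsProbabilityMeasure P₁)
      (_ : IsProbabilityMeasure P₂) (F₁ : Filtration ℝ≥0 m₁) (F₂ : Filtration ℝ≥0 m₂)
      (B₁ : Fin N → ℝ≥0 → Ω₁ → ℝ) (B₂ : Fin N → ℝ≥0 → Ω₂ → ℝ)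
      (X₁ : ℝ≥0 → Ω₁ → EuclideanSpace ℝ (Fin N)) (X₂ : ℝ≥0 → Ω₂ → EuclideanSpace ℝ (Fin N)),
      IsSolution U V (σ N) (D N) P₁ F₁ B₁ X₁ → IsSolution U V (σ N) (D N) P₂ F₂ B₂ X₂ →
      ∀ t : ℝ≥0, W2 (P₁.map (X₁ t)) (P₂.map (X₂ t)) ≤
        ENNReal.ofReal (Real.exp (-κ * t)) * W2 (P₁.map (X₁ 0)) (P₂.map (X₂ 0))

/-- The function `t ↦ E ((1/N) ∑ i, |X^i_t - X^i_0|²)` is continuous at `t = 0`, uniformly in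
`N ≥ 1`. -/
def UniformContinuityAtZero {Ω : ℕ → Type*} [∀ N, MeasurableSpace (Ω N)]
    (P : ∀ N, Measure (Ω N)) (X : ∀ N, ℝ≥0 → Ω N → EuclideanSpace ℝ (Fin N)) : Prop :=
  ∀ ε : ℝ, 0 < ε → ∃ δ : ℝ≥0, 0 < δ ∧ ∀ t : ℝ≥0, t < δ → ∀ N : ℕ, 1 ≤ N →
    ∫⁻ ω, ENNReal.ofReal ((1 / (N : ℝ)) * ∑ i, |X N t ω i - X N 0 ω i| ^ 2) ∂(P N)
      ≤ ENNReal.ofReal ε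

end ParticleChaos

end

/-!
Fix two times `s` and `t = s + h`. The equation is autonomous: the process restarted at
time `h` is again a solution (`IsSolution.shift`), so the contraction hypothesis bounds the `W2`
distance between the laws of the system at times `s` and `s + h` by `exp (-κ s)` times the distance
between its laws at times `0` and `h`. In the normalization of the particle average, the latter is
at most the root mean square displacement between the times `0` and `h`
(`inv_sqrt_mul_W2_map_le`), which is bounded uniformly in `h` and `N` by the moment bound, and is
small uniformly in `N` for small `h` by continuity at `0`. Since `x ↦ empiricalMeasure x` is
Lipschitz in `W2`, integrating the triangle inequality against a nearly optimal coupling of the two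
laws compares the expected errors at the two times, up to the distance of the limits `ρ s` and
`ρ t`; letting `N → ∞` shows that this distance obeys the same bound
(`lintegral_W2_le_add_displacement`). Hence convergence at the finitely many points of a fine grid
of a long interval `[0, T]` gives convergence uniformly on `[0, ∞)`: a time in `[0, T]` is close to
a grid point, and after time `T` the factor `exp (-κ T)` makes any displacement harmless.

What remains is convergence of the expected `W2` distance at one time
(`tendsto_lintegral_W2_of_weak`). Weak convergence in probability says that the masses given to
the cells of a smoothed partition of a large interval converge. Two measures with nearly the same
cell masses have a coupling that stays inside the cells up to a small mass, and the fourth moments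
control the cost of that remaining mass (`W2_sq_le_of_partition`).

The triangle inequality for `W2` is obtained by gluing couplings along a common marginal with a
conditional kernel (`exists_gluing`). It also gives the measurability of the distances of random
empirical measures, through continuity, which the additivity of lower integrals requires.
-/

namespace ParticleChaos

/-! ### Couplings and the Wasserstein distance -/

section Wasserstein

variable {E : Type*} [MeasurableSpace E] [PseudoEMetricSpace E]

lemma W2_le_of_coupling {μ ν : Measure E} {Γ : Measure (E × E)} (h₁ : Γ.map Prod.fst = μ)
    (h₂ : Γ.map Prod.snd = ν) :
    W2 μ ν ≤ (∫⁻ z, edist z.1 z.2 ^ 2 ∂Γ) ^ (1 / 2 : ℝ) :=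
  ENNReal.rpow_le_rpow (iInf₂_le Γ ⟨h₁, h₂⟩) (by norm_num)

lemma exists_coupling_of_W2_lt {μ ν : Measure E} {c : ℝ≥0∞} (h : W2 μ ν < c) :
    ∃ Γ : Measure (E × E), Γ.map Prod.fst = μ ∧ Γ.map Prod.snd = ν ∧
      (∫⁻ z, edist z.1 z.2 ^ 2 ∂Γ) ^ (1 / 2 : ℝ) < c := by
  have h' := (ENNReal.lt_rpow_inv_iff (x := (⨅ (Γ : Measure (E × E))
    (_ : Γ.map Prod.fst = μ ∧ Γ.map Prod.snd = ν), ∫⁻ z, edist z.1 z.2 ^ 2 ∂Γ)) (y := c)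
    (z := (1 / 2 : ℝ)) (by norm_num)).2 h
  obtain ⟨Γ, hΓ⟩ := iInf_lt_iff.1 h'
  obtain ⟨hm, hΓ⟩ := iInf_lt_iff.1 hΓ
  exact ⟨Γ, hm.1, hm.2, (ENNReal.lt_rpow_inv_iff (by norm_num)).1 hΓ⟩

/-- A bound that holds with the cost of every coupling holds with `W2`; no optimal coupling is
needed. -/
lemma W2_le_of_forall_coupling {μ ν : Measure E} {a b : ℝ≥0∞}
    (h : ∀ Γ : Measure (E × E), Γ.map Prod.fst = μ → Γ.map Prod.snd = ν →
      a ≤ b + (∫⁻ z, edist z.1 z.2 ^ 2 ∂Γ) ^ (1 / 2 : ℝ)) : a ≤ b + W2 μ ν := by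
  refine le_of_forall_gt_imp_ge_of_dense fun c hc => ?_
  by_cases hb : b = ∞
  · simp [hb] at hc
  obtain ⟨Γ, h₁, h₂, hΓ⟩ := exists_coupling_of_W2_lt
    (show W2 μ ν < c - b from lt_tsub_iff_left.2 hc)
  exact (h Γ h₁ h₂).trans (lt_tsub_iff_left.1 hΓ).le

lemma isProbabilityMeasure_of_map {α β : Type*} [MeasurableSpace α] [MeasurableSpace β]
    {Γ : Measure α} {f : α → β} {μ : Measure β} [IsProbabilityMeasure μ] (hf : Measurable f)
    (h : Γ.map f = μ) : IsProbabilityMeasure Γ := by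
  constructor
  rw [← Set.preimage_univ (f := f), ← Measure.map_apply hf MeasurableSet.univ, h, measure_univ]

lemma W2_comm [OpensMeasurableSpace E] [SecondCountableTopology E] (μ ν : Measure E) :
    W2 μ ν = W2 ν μ := by
  suffices H : ∀ μ ν : Measure E, W2 μ ν ≤ W2 ν μ from le_antisymm (H _ _) (H _ _)
  intro μ ν
  rw [← zero_add (W2 ν μ)]
  refine W2_le_of_forall_coupling fun Γ h₁ h₂ => ?_
  rw [zero_add]
  refine (W2_le_of_coupling (Γ := Γ.map Prod.swap) ?_ ?_).trans_eq ?_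
  · rw [Measure.map_map measurable_fst measurable_swap]; exact h₂
  · rw [Measure.map_map measurable_snd measurable_swap]; exact h₁
  · rw [lintegral_map (by fun_prop) measurable_swap]
    simp [edist_comm]

/-- Two couplings with a common marginal can be glued: the third coordinate is drawn from the
conditional law of the second coupling given its first coordinate. -/
lemma exists_gluing {E : Type*} [MeasurableSpace E] [StandardBorelSpace E] [Nonempty E]
    {ν : Measure E} [IsProbabilityMeasure ν] {Γ₁ Γ₂ : Measure (E × E)}
    (h₂ : Γ₁.map Prod.snd = ν) (h₃ : Γ₂.map Prod.fst = ν) :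
    ∃ Θ : Measure ((E × E) × E), Θ.map Prod.fst = Γ₁ ∧
      Θ.map (fun z => (z.1.2, z.2)) = Γ₂ := by
  have := isProbabilityMeasure_of_map measurable_snd h₂
  have := isProbabilityMeasure_of_map measurable_fst h₃
  refine ⟨Γ₁ ⊗ₘ (Γ₂.condKernel.comap Prod.snd measurable_snd), ?_, ?_⟩
  · exact Measure.fst_compProd Γ₁ _
  · have key : Γ₂ = ν ⊗ₘ Γ₂.condKernel := by
      rw [← h₃]; exact (Γ₂.disintegrate Γ₂.condKernel).symm
    conv_rhs => rw [key]
    ext s hs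
    have hmeas : Measurable fun z : (E × E) × E => (z.1.2, z.2) := by fun_prop
    rw [Measure.map_apply hmeas hs, Measure.compProd_apply (hmeas hs),
      Measure.compProd_apply hs, ← h₂, lintegral_map _ measurable_snd]
    · rfl
    · exact Kernel.measurable_kernel_prodMk_left hs

lemma W2_triangle [OpensMeasurableSpace E] [SecondCountableTopology E] [StandardBorelSpace E]
    [Nonempty E] (μ ν ρ : Measure E) [IsProbabilityMeasure ν] :
    W2 μ ρ ≤ W2 μ ν + W2 ν ρ := by
  refine W2_le_of_forall_coupling fun Γ₂ h₃ h₄ => ?_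
  rw [add_comm]
  refine W2_le_of_forall_coupling fun Γ₁ h₁ h₂ => ?_
  rw [add_comm]
  obtain ⟨Θ, hΘ₁, hΘ₂⟩ := exists_gluing h₂ h₃
  have hm₁ : Measurable fun z : (E × E) × E => (z.1.1, z.2) := by fun_prop
  have hm₂ : Measurable fun z : (E × E) × E => (z.1.2, z.2) := by fun_prop
  calc W2 μ ρ ≤ (∫⁻ z, edist z.1 z.2 ^ 2 ∂(Θ.map fun z => (z.1.1, z.2))) ^ (1 / 2 : ℝ) := by
        refine W2_le_of_coupling ?_ ?_
        · rw [Measure.map_map measurable_fst hm₁, ← h₁, ← hΘ₁,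
            Measure.map_map measurable_fst measurable_fst]; rfl
        · rw [Measure.map_map measurable_snd hm₁, ← h₄, ← hΘ₂,
            Measure.map_map measurable_snd hm₂]; rfl
    _ ≤ (∫⁻ z, (edist z.1.1 z.1.2 + edist z.1.2 z.2) ^ (2 : ℝ) ∂Θ) ^ (1 / 2 : ℝ) := by
        rw [lintegral_map (by fun_prop) hm₁]
        refine ENNReal.rpow_le_rpow (lintegral_mono fun z => ?_) (by norm_num)
        simp only [ENNReal.rpow_two]
        gcongr
        exact edist_triangle _ _ _
    _ ≤ (∫⁻ z, edist z.1.1 z.1.2 ^ (2 : ℝ) ∂Θ) ^ (1 / 2 : ℝ)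
        + (∫⁻ z, edist z.1.2 z.2 ^ (2 : ℝ) ∂Θ) ^ (1 / 2 : ℝ) :=
        ENNReal.lintegral_Lp_add_le (f := fun z : (E × E) × E => edist z.1.1 z.1.2)
          (g := fun z : (E × E) × E => edist z.1.2 z.2) (by fun_prop) (by fun_prop) (by norm_num)
    _ = _ := by
        simp only [ENNReal.rpow_two]
        rw [← hΘ₁, ← hΘ₂, lintegral_map (by fun_prop) measurable_fst,
          lintegral_map (by fun_prop) hm₂]

end Wasserstein

/-! ### Empirical measures -/

section Empirical

variable {N : ℕ}

lemma isProbabilityMeasure_empiricalMeasure (hN : 1 ≤ N) (x : EuclideanSpace ℝ (Fin N)) :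
    IsProbabilityMeasure (empiricalMeasure x) := by
  constructor
  have h0 : (N : ℝ≥0∞) ≠ 0 := by exact_mod_cast (by omega : N ≠ 0)
  simp [empiricalMeasure, ENNReal.inv_mul_cancel h0]

lemma lintegral_empiricalMeasure (x : EuclideanSpace ℝ (Fin N)) (f : ℝ → ℝ≥0∞) :
    ∫⁻ y, f y ∂(empiricalMeasure x) = (N : ℝ≥0∞)⁻¹ * ∑ i, f (x i) := by
  simp [empiricalMeasure]

lemma integral_empiricalMeasure (x : EuclideanSpace ℝ (Fin N)) (f : ℝ → ℝ) :
    ∫ y, f y ∂(empiricalMeasure x) = (N : ℝ)⁻¹ * ∑ i, f (x i) := by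
  rw [empiricalMeasure, integral_smul_measure, integral_finsetSum_measure]
  · simp
  · intro i _
    exact integrable_dirac (by simp)

/-- Matching the particles of equal index couples the two empirical measures. -/
lemma W2_empiricalMeasure_le (x y : EuclideanSpace ℝ (Fin N)) :
    W2 (empiricalMeasure x) (empiricalMeasure y) ≤
      ((N : ℝ≥0∞)⁻¹) ^ (1 / 2 : ℝ) * edist x y := by
  refine (W2_le_of_coupling (Γ := (N : ℝ≥0∞)⁻¹ • ∑ i, Measure.dirac (x i, y i)) ?_ ?_).trans_eq ?_
  · rw [empiricalMeasure, ← Measure.mapₗ_apply_of_measurable measurable_fst, map_smul, map_sum]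
    simp [Measure.mapₗ_apply_of_measurable measurable_fst, Measure.map_dirac' measurable_fst]
  · rw [empiricalMeasure, ← Measure.mapₗ_apply_of_measurable measurable_snd, map_smul, map_sum]
    simp [Measure.mapₗ_apply_of_measurable measurable_snd, Measure.map_dirac' measurable_snd]
  · rw [EuclideanSpace.edist_eq, ← ENNReal.mul_rpow_of_nonneg _ _ (by norm_num)]
    simp

lemma continuous_W2_empiricalMeasure (hN : 1 ≤ N) (ν : Measure ℝ) :
    Continuous fun x : EuclideanSpace ℝ (Fin N) => W2 (empiricalMeasure x) ν := by
  have h0 : (N : ℝ≥0∞) ≠ 0 := by exact_mod_cast (by omega : N ≠ 0)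
  refine continuous_of_le_add_edist (((N : ℝ≥0∞)⁻¹) ^ (1 / 2 : ℝ))
    (ENNReal.rpow_ne_top_of_nonneg (by norm_num) (by simpa using h0)) fun x y => ?_
  have := isProbabilityMeasure_empiricalMeasure hN y
  calc _ ≤ W2 (empiricalMeasure x) (empiricalMeasure y) + W2 (empiricalMeasure y) ν :=
        W2_triangle _ _ _
    _ ≤ _ := by rw [add_comm]; gcongr; exact W2_empiricalMeasure_le x y

end Empirical

/-! ### Integrated triangle inequalities -/

section Comparison

lemma W2_le_of_forall_coupling_mul {E : Type*} [MeasurableSpace E] [PseudoEMetricSpace E]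
    {μ ν : Measure E} {a b c : ℝ≥0∞} (hc₀ : c ≠ 0) (hc : c ≠ ∞)
    (h : ∀ Γ : Measure (E × E), Γ.map Prod.fst = μ → Γ.map Prod.snd = ν →
      a ≤ b + c * (∫⁻ z, edist z.1 z.2 ^ 2 ∂Γ) ^ (1 / 2 : ℝ)) : a ≤ b + c * W2 μ ν := by
  rw [← tsub_le_iff_left, mul_comm, ← ENNReal.div_le_iff hc₀ hc, ← zero_add (W2 μ ν)]
  refine W2_le_of_forall_coupling fun Γ h₁ h₂ => ?_
  rw [zero_add, ENNReal.div_le_iff hc₀ hc, mul_comm, tsub_le_iff_left]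
  exact h Γ h₁ h₂

lemma lintegral_le_sqrt_lintegral_sq {α : Type*} [MeasurableSpace α] (μ : Measure α)
    [IsProbabilityMeasure μ] {f : α → ℝ≥0∞} (hf : AEMeasurable f μ) :
    ∫⁻ x, f x ∂μ ≤ (∫⁻ x, f x ^ 2 ∂μ) ^ (1 / 2 : ℝ) := by
  have := ENNReal.lintegral_mul_le_Lp_mul_Lq μ (f := f) (g := fun _ => 1)
    Real.HolderConjugate.two_two hf aemeasurable_const
  simpa using this

variable {N : ℕ}

lemma natCast_inv_sqrt_ne_zero : ((N : ℝ≥0∞)⁻¹) ^ (1 / 2 : ℝ) ≠ 0 := by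
  simp

lemma natCast_inv_sqrt_ne_top (hN : 1 ≤ N) : ((N : ℝ≥0∞)⁻¹) ^ (1 / 2 : ℝ) ≠ ∞ := by
  have h0 : (N : ℝ≥0∞) ≠ 0 := by exact_mod_cast (by omega : N ≠ 0)
  exact ENNReal.rpow_ne_top_of_nonneg (by norm_num) (by simpa using h0)

lemma lintegral_const_mul_edist_le {E : Type*} [MeasurableSpace E] [PseudoEMetricSpace E]
    [OpensMeasurableSpace E] [SecondCountableTopology E] (Γ : Measure (E × E))
    [IsProbabilityMeasure Γ] (c : ℝ≥0∞) :
    ∫⁻ z, c * edist z.1 z.2 ∂Γ ≤ c * (∫⁻ z, edist z.1 z.2 ^ 2 ∂Γ) ^ (1 / 2 : ℝ) := by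
  rw [lintegral_const_mul _ (by fun_prop)]
  gcongr
  exact lintegral_le_sqrt_lintegral_sq Γ (by fun_prop)

/-- The triangle inequality through `empiricalMeasure x` and `μ`, integrated over couplings of the
laws `M₁` and `M₂` of the two configurations. -/
lemma lintegral_W2_empiricalMeasure_le (hN : 1 ≤ N)
    (M₁ M₂ : Measure (EuclideanSpace ℝ (Fin N))) [IsProbabilityMeasure M₁]
    (μ ν : Measure ℝ) [IsProbabilityMeasure μ] :
    ∫⁻ y, W2 (empiricalMeasure y) ν ∂M₂ ≤
      ∫⁻ x, W2 (empiricalMeasure x) μ ∂M₁ + W2 μ ν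
        + ((N : ℝ≥0∞)⁻¹) ^ (1 / 2 : ℝ) * W2 M₁ M₂ := by
  refine W2_le_of_forall_coupling_mul natCast_inv_sqrt_ne_zero (natCast_inv_sqrt_ne_top hN)
    fun Γ h₁ h₂ => ?_
  have := isProbabilityMeasure_of_map measurable_fst h₁
  have hμ := (continuous_W2_empiricalMeasure hN μ).measurable
  have hν := (continuous_W2_empiricalMeasure hN ν).measurable
  calc ∫⁻ y, W2 (empiricalMeasure y) ν ∂M₂
      = ∫⁻ z, W2 (empiricalMeasure z.2) ν ∂Γ := by
        rw [← h₂, lintegral_map hν measurable_snd]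
    _ ≤ ∫⁻ z, (W2 (empiricalMeasure z.1) μ + W2 μ ν
          + ((N : ℝ≥0∞)⁻¹) ^ (1 / 2 : ℝ) * edist z.1 z.2) ∂Γ := by
        refine lintegral_mono fun z => ?_
        have := isProbabilityMeasure_empiricalMeasure hN z.1
        calc _ ≤ W2 (empiricalMeasure z.2) (empiricalMeasure z.1)
              + W2 (empiricalMeasure z.1) ν := W2_triangle _ _ _
          _ ≤ ((N : ℝ≥0∞)⁻¹) ^ (1 / 2 : ℝ) * edist z.1 z.2
              + (W2 (empiricalMeasure z.1) μ + W2 μ ν) := by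
            gcongr
            · rw [edist_comm]; exact W2_empiricalMeasure_le _ _
            · exact W2_triangle _ _ _
          _ = _ := add_comm _ _
    _ = ∫⁻ x, W2 (empiricalMeasure x) μ ∂M₁ + W2 μ ν
          + ∫⁻ z, ((N : ℝ≥0∞)⁻¹) ^ (1 / 2 : ℝ) * edist z.1 z.2 ∂Γ := by
        rw [lintegral_add_right _ (by fun_prop), lintegral_add_right _ measurable_const,
          lintegral_const, measure_univ, mul_one, ← h₁, lintegral_map hμ measurable_fst]
    _ ≤ _ := by
        gcongr
        exact lintegral_const_mul_edist_le Γ _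

/-- The triangle inequality through the two empirical measures, integrated over couplings of the
laws `M₁` and `M₂` of the two configurations. -/
lemma W2_le_lintegral_W2_empiricalMeasure (hN : 1 ≤ N)
    (M₁ M₂ : Measure (EuclideanSpace ℝ (Fin N))) [IsProbabilityMeasure M₁]
    (μ ν : Measure ℝ) :
    W2 μ ν ≤ ∫⁻ x, W2 (empiricalMeasure x) μ ∂M₁ + ∫⁻ y, W2 (empiricalMeasure y) ν ∂M₂
        + ((N : ℝ≥0∞)⁻¹) ^ (1 / 2 : ℝ) * W2 M₁ M₂ := by
  refine W2_le_of_forall_coupling_mul natCast_inv_sqrt_ne_zero (natCast_inv_sqrt_ne_top hN)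
    fun Γ h₁ h₂ => ?_
  have := isProbabilityMeasure_of_map measurable_fst h₁
  have hμ := (continuous_W2_empiricalMeasure hN μ).measurable
  have hν := (continuous_W2_empiricalMeasure hN ν).measurable
  calc W2 μ ν = ∫⁻ _, W2 μ ν ∂Γ := by simp
    _ ≤ ∫⁻ z, (W2 (empiricalMeasure z.1) μ + W2 (empiricalMeasure z.2) ν
          + ((N : ℝ≥0∞)⁻¹) ^ (1 / 2 : ℝ) * edist z.1 z.2) ∂Γ := by
        refine lintegral_mono fun z => ?_
        have := isProbabilityMeasure_empiricalMeasure hN z.1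
        have := isProbabilityMeasure_empiricalMeasure hN z.2
        calc W2 μ ν ≤ W2 μ (empiricalMeasure z.1) + W2 (empiricalMeasure z.1) ν :=
              W2_triangle _ _ _
          _ ≤ W2 (empiricalMeasure z.1) μ + (((N : ℝ≥0∞)⁻¹) ^ (1 / 2 : ℝ) * edist z.1 z.2
              + W2 (empiricalMeasure z.2) ν) := by
            rw [W2_comm μ]
            gcongr
            refine (W2_triangle _ (empiricalMeasure z.2) _).trans ?_
            gcongr
            exact W2_empiricalMeasure_le _ _
          _ = _ := by ring
    _ = ∫⁻ x, W2 (empiricalMeasure x) μ ∂M₁ + ∫⁻ y, W2 (empiricalMeasure y) ν ∂M₂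
          + ∫⁻ z, ((N : ℝ≥0∞)⁻¹) ^ (1 / 2 : ℝ) * edist z.1 z.2 ∂Γ := by
        rw [lintegral_add_right _ (by fun_prop),
          lintegral_add_right _ (show Measurable fun z : _ × _ => W2 (empiricalMeasure z.2) ν from
            hν.comp measurable_snd),
          ← h₁, lintegral_map hμ measurable_fst, ← h₂, lintegral_map hν measurable_snd]
    _ ≤ _ := by
        gcongr
        exact lintegral_const_mul_edist_le Γ _

end Comparison

/-! ### A coupling adapted to a partition -/

section PartitionCoupling

variable {E : Type*} [MeasurableSpace E]

/-- The weight `m / (a b)` makes the product of two measures of masses `a` and `b` have first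
marginal `m / a` times the first factor. With `0 / 0 = 0` this includes vanishing masses. -/
lemma map_fst_smul_prod {F : Type*} [MeasurableSpace F] (μ : Measure E) (ν : Measure F)
    [IsFiniteMeasure μ] [IsFiniteMeasure ν] {m : ℝ≥0∞} (hm : m ≤ ν Set.univ) :
    ((m / (μ Set.univ * ν Set.univ)) • μ.prod ν).map Prod.fst = (m / μ Set.univ) • μ := by
  rw [Measure.map_smul, Measure.map_fst_prod, smul_smul]
  rcases eq_or_ne (ν Set.univ) 0 with h | h
  · have : m = 0 := by simpa [h] using hm
    simp [this]
  rcases eq_or_ne (μ Set.univ) 0 with h' | h'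
  · simp [Measure.measure_univ_eq_zero.1 h']
  congr 1
  rw [div_eq_mul_inv, ENNReal.mul_inv (Or.inl h') (Or.inl (measure_ne_top _ _)), mul_assoc,
    mul_assoc, ENNReal.inv_mul_cancel h (measure_ne_top _ _), mul_one, div_eq_mul_inv]

lemma map_snd_smul_prod {F : Type*} [MeasurableSpace F] (μ : Measure E) (ν : Measure F)
    [IsFiniteMeasure μ] [IsFiniteMeasure ν] {m : ℝ≥0∞} (hm : m ≤ μ Set.univ) :
    ((m / (μ Set.univ * ν Set.univ)) • μ.prod ν).map Prod.snd = (m / ν Set.univ) • ν := by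
  rw [← map_fst_smul_prod ν μ hm, ← Measure.prod_swap, Measure.map_smul, Measure.map_smul,
    Measure.map_map measurable_snd measurable_swap, mul_comm]
  rfl

/-- Removing from `μ` a fraction `m k / ∫ φ k dμ` of each piece `φ k μ` leaves a measure of mass
`1 - ∑ k, m k`. -/
lemma exists_residual {ι : Type*} [Fintype ι] (μ : Measure E) [IsProbabilityMeasure μ]
    {φ : ι → E → ℝ≥0∞} (hφ : ∀ k, Measurable (φ k)) (hφ₁ : ∀ x, ∑ k, φ k x ≤ 1)
    {m : ι → ℝ≥0∞} (hm : ∀ k, m k ≤ ∫⁻ x, φ k x ∂μ) :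
    ∃ μ' : Measure E, μ' + ∑ k, (m k / ∫⁻ x, φ k x ∂μ) • μ.withDensity (φ k) = μ ∧
      μ' Set.univ = 1 - ∑ k, m k := by
  have hα : ∀ k, m k / ∫⁻ x, φ k x ∂μ ≤ 1 := fun k => ENNReal.div_le_of_le_mul (by simpa using hm k)
  set g : E → ℝ≥0∞ := fun x => ∑ k, (m k / ∫⁻ x, φ k x ∂μ) * φ k x with hg
  have hg₁ : ∀ x, g x ≤ 1 := fun x =>
    (Finset.sum_le_sum fun k _ => mul_le_of_le_one_left' (hα k)).trans (hφ₁ x)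
  have hgm : Measurable g := by fun_prop
  have hsum : ∑ k, (m k / ∫⁻ x, φ k x ∂μ) • μ.withDensity (φ k) = μ.withDensity g := by
    ext s hs
    rw [withDensity_apply _ hs, hg, lintegral_finsetSum _ (fun k _ => by fun_prop)]
    simp only [Measure.coe_finsetSum, Measure.coe_smul, Finset.sum_apply, Pi.smul_apply,
      smul_eq_mul]
    refine Finset.sum_congr rfl fun k _ => ?_
    rw [withDensity_apply _ hs, lintegral_const_mul _ (hφ k)]
  have hadd : μ.withDensity (fun x => 1 - g x) + μ.withDensity g = μ := by
    rw [← withDensity_add_right _ hgm]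
    have : (fun x => 1 - g x) + g = 1 := by
      ext x; simp [tsub_add_cancel_of_le (hg₁ x)]
    rw [this, withDensity_one]
  refine ⟨μ.withDensity fun x => 1 - g x, by rw [hsum, hadd], ?_⟩
  have hmass : μ.withDensity g Set.univ = ∑ k, m k := by
    rw [← hsum]
    simp only [Measure.coe_finsetSum, Measure.coe_smul, Finset.sum_apply, Pi.smul_apply,
      smul_eq_mul, withDensity_apply _ MeasurableSet.univ, Measure.restrict_univ]
    refine Finset.sum_congr rfl fun k _ => ?_
    refine ENNReal.div_mul_cancel' (fun h => by simpa [h] using hm k) (fun h => ?_)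
    have : ∫⁻ x, φ k x ∂μ ≤ 1 := by
      calc _ ≤ ∫⁻ _, 1 ∂μ := lintegral_mono fun x =>
            (Finset.single_le_sum (fun _ _ => zero_le) (Finset.mem_univ k)).trans (hφ₁ x)
        _ = 1 := by simp
    simp [h] at this
  have h1 : μ.withDensity (fun x => 1 - g x) Set.univ + ∑ k, m k = 1 := by
    rw [← hmass, ← Measure.add_apply, hadd, measure_univ]
  refine ENNReal.eq_sub_of_add_eq (fun h => ?_) h1
  simp [h] at h1

/-- Truncation of the second moment at level `L`, the excess being absorbed by the fourth moment. -/
lemma enorm_sq_le_add (x : ℝ) {L : ℝ≥0∞} (hL : L ≠ 0) (hL' : L ≠ ∞) :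
    ‖x‖ₑ ^ 2 ≤ L + L⁻¹ * ‖x‖ₑ ^ 4 := by
  rcases le_total (‖x‖ₑ ^ 2) L with h | h
  · exact h.trans le_self_add
  · calc ‖x‖ₑ ^ 2 = L⁻¹ * (L * ‖x‖ₑ ^ 2) := by
          rw [← mul_assoc, ENNReal.inv_mul_cancel hL hL', one_mul]
      _ ≤ L⁻¹ * (‖x‖ₑ ^ 2 * ‖x‖ₑ ^ 2) := by gcongr
      _ = L⁻¹ * ‖x‖ₑ ^ 4 := by ring
      _ ≤ _ := le_add_self

lemma edist_sq_le_two_mul (x y : ℝ) : edist x y ^ 2 ≤ 2 * ‖x‖ₑ ^ 2 + 2 * ‖y‖ₑ ^ 2 := by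
  have h1 : edist x y ≤ ‖x‖ₑ + ‖y‖ₑ := by
    rw [edist_eq_enorm_sub]; exact enorm_sub_le
  calc edist x y ^ 2 ≤ (‖x‖ₑ + ‖y‖ₑ) ^ 2 := by gcongr
    _ ≤ 2 ^ (2 - 1 : ℝ) * (‖x‖ₑ ^ 2 + ‖y‖ₑ ^ 2) := by
        have := ENNReal.rpow_add_le_mul_rpow_add_rpow ‖x‖ₑ ‖y‖ₑ (p := 2) (by norm_num)
        simpa only [ENNReal.rpow_two] using this
    _ = _ := by norm_num [mul_add]

/-- A quantitative comparison of `W2` with the masses that two measures give to small cells.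
The functions `φ k` are a smoothed partition into cells of diameter at most `η`; the two measures
are matched as far as possible inside the cells, and the mass `1 - ∑ k, min (a k) (b k)` left over
is coupled independently, its cost being controlled by the fourth moments. -/
lemma W2_sq_le_of_partition {ι : Type*} [Fintype ι] (μ ν : Measure ℝ) [IsProbabilityMeasure μ]
    [IsProbabilityMeasure ν] {φ : ι → ℝ → ℝ≥0∞} (hφ : ∀ k, Measurable (φ k))
    (hφ₁ : ∀ x, ∑ k, φ k x ≤ 1) {η : ℝ≥0∞}
    (hη : ∀ k x y, φ k x ≠ 0 → φ k y ≠ 0 → edist x y ≤ η) {L : ℝ≥0∞} (hL : L ≠ 0)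
    (hL' : L ≠ ∞) :
    W2 μ ν ^ 2 ≤ η ^ 2
      + 4 * L * (1 - ∑ k, min (∫⁻ x, φ k x ∂μ) (∫⁻ x, φ k x ∂ν))
      + 2 * L⁻¹ * (∫⁻ x, ‖x‖ₑ ^ 4 ∂μ + ∫⁻ x, ‖x‖ₑ ^ 4 ∂ν) := by
  set m : ι → ℝ≥0∞ := fun k => min (∫⁻ x, φ k x ∂μ) (∫⁻ x, φ k x ∂ν) with hm
  obtain ⟨μ', hμ', hμr⟩ := exists_residual μ hφ hφ₁ (m := m) (fun k => min_le_left _ _)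
  obtain ⟨ν', hν', hνr⟩ := exists_residual ν hφ hφ₁ (m := m) (fun k => min_le_right _ _)
  have hμ'le : μ' ≤ μ := by conv_rhs => rw [← hμ']
                            exact Measure.le_add_right le_rfl
  have hν'le : ν' ≤ ν := by conv_rhs => rw [← hν']
                            exact Measure.le_add_right le_rfl
  have : IsFiniteMeasure μ' := isFiniteMeasure_of_le μ hμ'le
  have : IsFiniteMeasure ν' := isFiniteMeasure_of_le ν hν'le
  set r : ℝ≥0∞ := 1 - ∑ k, m k with hr
  have hlt : ∀ (κ : Measure ℝ) [IsProbabilityMeasure κ] k, ∫⁻ x, φ k x ∂κ ≠ ∞ := by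
    intro κ _ k
    refine ne_top_of_le_ne_top ENNReal.one_ne_top ?_
    calc _ ≤ ∫⁻ _, 1 ∂κ := lintegral_mono fun x =>
          (Finset.single_le_sum (fun _ _ => zero_le) (Finset.mem_univ k)).trans (hφ₁ x)
      _ = 1 := by simp
  have : ∀ k, IsFiniteMeasure (μ.withDensity (φ k)) := fun k =>
    isFiniteMeasure_withDensity (hlt μ k)
  have : ∀ k, IsFiniteMeasure (ν.withDensity (φ k)) := fun k =>
    isFiniteMeasure_withDensity (hlt ν k)
  have hmass : ∀ (κ : Measure ℝ) k, κ.withDensity (φ k) Set.univ = ∫⁻ x, φ k x ∂κ := by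
    intro κ k; simp
  set Γ₀ : Measure (ℝ × ℝ) := (r / (μ' Set.univ * ν' Set.univ)) • μ'.prod ν' with hΓ₀
  set Γ : ι → Measure (ℝ × ℝ) := fun k =>
    (m k / (μ.withDensity (φ k) Set.univ * ν.withDensity (φ k) Set.univ)) •
      (μ.withDensity (φ k)).prod (ν.withDensity (φ k)) with hΓ
  -- When `r = 0` the remainders vanish, in agreement with `r / r = 0`.
  have hcancel : ∀ (κ : Measure ℝ), κ Set.univ = r → (r / κ Set.univ) • κ = κ := by
    intro κ hκ
    rw [hκ]
    rcases eq_or_ne r 0 with h | h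
    · rw [h] at hκ; simp [Measure.measure_univ_eq_zero.1 hκ]
    · rw [ENNReal.div_self h (by simp [hr]), one_smul]
  have hΓ₀₁ : Γ₀.map Prod.fst = μ' := by
    rw [hΓ₀, map_fst_smul_prod _ _ hνr.ge, hcancel _ hμr]
  have hΓ₀₂ : Γ₀.map Prod.snd = ν' := by
    rw [hΓ₀, map_snd_smul_prod _ _ hμr.ge, hcancel _ hνr]
  have hΓ₁ : ∀ k, (Γ k).map Prod.fst = (m k / ∫⁻ x, φ k x ∂μ) • μ.withDensity (φ k) := by
    intro k
    rw [hΓ, map_fst_smul_prod _ _ (by rw [hmass]; exact min_le_right _ _), hmass]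
  have hΓ₂ : ∀ k, (Γ k).map Prod.snd = (m k / ∫⁻ x, φ k x ∂ν) • ν.withDensity (φ k) := by
    intro k
    rw [hΓ, map_snd_smul_prod _ _ (by rw [hmass]; exact min_le_left _ _), hmass]
  have hcoup : W2 μ ν ≤ (∫⁻ z, edist z.1 z.2 ^ 2 ∂(Γ₀ + ∑ k, Γ k)) ^ (1 / 2 : ℝ) := by
    refine W2_le_of_coupling ?_ ?_
    · conv_rhs => rw [← hμ']
      rw [← Measure.mapₗ_apply_of_measurable measurable_fst, map_add, map_sum]
      simp only [Measure.mapₗ_apply_of_measurable measurable_fst, hΓ₀₁, hΓ₁]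
    · conv_rhs => rw [← hν']
      rw [← Measure.mapₗ_apply_of_measurable measurable_snd, map_add, map_sum]
      simp only [Measure.mapₗ_apply_of_measurable measurable_snd, hΓ₀₂, hΓ₂]
  -- The remainders have mass `r` and inherit the fourth moments, which bounds their second moments.
  have hmom : ∀ (κ' κ : Measure ℝ), κ' ≤ κ → κ' Set.univ = r →
      ∫⁻ x, ‖x‖ₑ ^ 2 ∂κ' ≤ L * r + L⁻¹ * ∫⁻ x, ‖x‖ₑ ^ 4 ∂κ := by
    intro κ' κ hle hκ
    calc ∫⁻ x, ‖x‖ₑ ^ 2 ∂κ' ≤ ∫⁻ x, (L + L⁻¹ * ‖x‖ₑ ^ 4) ∂κ' :=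
          lintegral_mono fun x => enorm_sq_le_add x hL hL'
      _ = L * r + L⁻¹ * ∫⁻ x, ‖x‖ₑ ^ 4 ∂κ' := by
          rw [lintegral_add_left measurable_const, lintegral_const, hκ,
            lintegral_const_mul _ (by fun_prop)]
      _ ≤ _ := by gcongr
  have hcost₀ : ∫⁻ z, edist z.1 z.2 ^ 2 ∂Γ₀ ≤
      4 * L * r + 2 * L⁻¹ * (∫⁻ x, ‖x‖ₑ ^ 4 ∂μ + ∫⁻ x, ‖x‖ₑ ^ 4 ∂ν) := by
    calc ∫⁻ z, edist z.1 z.2 ^ 2 ∂Γ₀ ≤ ∫⁻ z, (2 * ‖z.1‖ₑ ^ 2 + 2 * ‖z.2‖ₑ ^ 2) ∂Γ₀ :=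
          lintegral_mono fun z => edist_sq_le_two_mul _ _
      _ = 2 * ∫⁻ x, ‖x‖ₑ ^ 2 ∂μ' + 2 * ∫⁻ x, ‖x‖ₑ ^ 2 ∂ν' := by
          rw [lintegral_add_left (by fun_prop), lintegral_const_mul _ (by fun_prop),
            lintegral_const_mul _ (by fun_prop), ← hΓ₀₁, ← hΓ₀₂,
            lintegral_map (by fun_prop) measurable_fst, lintegral_map (by fun_prop) measurable_snd]
      _ ≤ 2 * (L * r + L⁻¹ * ∫⁻ x, ‖x‖ₑ ^ 4 ∂μ) + 2 * (L * r + L⁻¹ * ∫⁻ x, ‖x‖ₑ ^ 4 ∂ν) := by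
          gcongr
          · exact hmom μ' μ hμ'le hμr
          · exact hmom ν' ν hν'le hνr
      _ = _ := by ring
  -- The coupling inside the cell `k` is carried by pairs of points both charged by `φ k`.
  have hcost : ∀ k, ∫⁻ z, edist z.1 z.2 ^ 2 ∂(Γ k) ≤ η ^ 2 * m k := by
    intro k
    have hae : ∀ (κ : Measure ℝ) (c : ℝ≥0∞), ∀ᵐ x ∂(c • κ.withDensity (φ k)), φ k x ≠ 0 := by
      intro κ c
      refine Measure.ae_smul_measure ?_ c
      rw [ae_withDensity_iff (hφ k)]
      exact ae_of_all _ fun x h => h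
    have h1 : ∀ᵐ z ∂(Γ k), φ k z.1 ≠ 0 := by
      refine ae_of_ae_map (p := fun x => φ k x ≠ 0) measurable_fst.aemeasurable ?_
      rw [hΓ₁]; exact hae _ _
    have h2 : ∀ᵐ z ∂(Γ k), φ k z.2 ≠ 0 := by
      refine ae_of_ae_map (p := fun x => φ k x ≠ 0) measurable_snd.aemeasurable ?_
      rw [hΓ₂]; exact hae _ _
    calc ∫⁻ z, edist z.1 z.2 ^ 2 ∂(Γ k) ≤ ∫⁻ _, η ^ 2 ∂(Γ k) := by
          refine lintegral_mono_ae ?_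
          filter_upwards [h1, h2] with z hz₁ hz₂
          gcongr
          exact hη k _ _ hz₁ hz₂
      _ = η ^ 2 * Γ k Set.univ := by simp
      _ ≤ η ^ 2 * m k := by
          gcongr
          rw [← Set.preimage_univ (f := Prod.fst), ← Measure.map_apply measurable_fst .univ, hΓ₁,
            Measure.smul_apply, hmass, smul_eq_mul]
          rw [mul_comm]
          exact ENNReal.mul_div_le
  have hsum1 : ∑ k, m k ≤ 1 := by
    calc ∑ k, m k ≤ ∑ k, ∫⁻ x, φ k x ∂μ := Finset.sum_le_sum fun k _ => min_le_left _ _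
      _ = ∫⁻ x, ∑ k, φ k x ∂μ := (lintegral_finsetSum _ fun k _ => hφ k).symm
      _ ≤ ∫⁻ _, 1 ∂μ := lintegral_mono hφ₁
      _ = 1 := by simp
  calc W2 μ ν ^ 2 ≤ ((∫⁻ z, edist z.1 z.2 ^ 2 ∂(Γ₀ + ∑ k, Γ k)) ^ (1 / 2 : ℝ)) ^ 2 := by gcongr
    _ = ∫⁻ z, edist z.1 z.2 ^ 2 ∂(Γ₀ + ∑ k, Γ k) := by
        rw [← ENNReal.rpow_two, ← ENNReal.rpow_mul]; norm_num
    _ = ∫⁻ z, edist z.1 z.2 ^ 2 ∂Γ₀ + ∑ k, ∫⁻ z, edist z.1 z.2 ^ 2 ∂(Γ k) := by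
        rw [lintegral_add_measure, lintegral_finsetSum_measure]
    _ ≤ (4 * L * r + 2 * L⁻¹ * (∫⁻ x, ‖x‖ₑ ^ 4 ∂μ + ∫⁻ x, ‖x‖ₑ ^ 4 ∂ν)) + ∑ k, η ^ 2 * m k := by
        gcongr with k
        exact hcost k
    _ ≤ (4 * L * r + 2 * L⁻¹ * (∫⁻ x, ‖x‖ₑ ^ 4 ∂μ + ∫⁻ x, ‖x‖ₑ ^ 4 ∂ν)) + η ^ 2 := by
        rw [← Finset.mul_sum]
        gcongr
        exact mul_le_of_le_one_right' hsum1
    _ = _ := by ring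

end PartitionCoupling

/-! ### Continuous partitions of an interval -/

section Partition

/-- The retraction of the line onto the unit interval. -/
def clampUnit (y : ℝ) : ℝ := max 0 (min 1 y)

lemma continuous_clampUnit : Continuous clampUnit := by unfold clampUnit; fun_prop

lemma clampUnit_mono : Monotone clampUnit := fun a b h => by unfold clampUnit; gcongr

lemma clampUnit_nonneg (y : ℝ) : 0 ≤ clampUnit y := le_max_left _ _

lemma clampUnit_le_one (y : ℝ) : clampUnit y ≤ 1 := by simp [clampUnit]

lemma clampUnit_of_one_le {y : ℝ} (h : 1 ≤ y) : clampUnit y = 1 := by simp [clampUnit, h]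

lemma clampUnit_of_nonpos {y : ℝ} (h : y ≤ 0) : clampUnit y = 0 := by
  simp [clampUnit, h]

/-- A continuous partition of `[-R, R]` into bumps of small support, obtained by telescoping
translates of `clampUnit`. -/
lemma exists_continuous_partition {η R : ℝ} (hη : 0 < η) :
    ∃ (n : ℕ) (f : Fin n → ℝ →ᵇ ℝ), (∀ k x, 0 ≤ f k x) ∧ (∀ x, ∑ k, f k x ≤ 1) ∧
      (∀ x, |x| ≤ R → ∑ k, f k x = 1) ∧
      ∀ k x y, f k x ≠ 0 → f k y ≠ 0 → |x - y| ≤ η := by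
  obtain ⟨n, hn⟩ := exists_nat_ge (2 * R / (η / 2) + 1)
  set u : ℝ → ℝ := fun x => (x + R) / (η / 2) + 1 with hu
  have hcont : ∀ k : ℕ, Continuous fun x => clampUnit (u x - k) - clampUnit (u x - (k + 1 : ℕ)) :=
    fun k => by
      have := continuous_clampUnit
      fun_prop
  have hnn : ∀ (k : ℕ) x, 0 ≤ clampUnit (u x - k) - clampUnit (u x - (k + 1 : ℕ)) := fun k x =>
    sub_nonneg.2 (clampUnit_mono (by push_cast; linarith))
  refine ⟨n, fun k => BoundedContinuousFunction.ofNormedAddCommGroup _ (hcont k) 1 fun x => ?_,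
    fun k x => hnn k x, fun x => ?_, fun x hx => ?_, fun k x y hx hy => ?_⟩
  · rw [Real.norm_of_nonneg (hnn k x)]
    linarith [clampUnit_nonneg (u x - (k + 1 : ℕ)), clampUnit_le_one (u x - k)]
  · simp only [BoundedContinuousFunction.coe_ofNormedAddCommGroup]
    rw [Fin.sum_univ_eq_sum_range
      (fun k => clampUnit (u x - k) - clampUnit (u x - (k + 1 : ℕ))) n, Finset.sum_range_sub'
      (fun k => clampUnit (u x - (k : ℕ)))]
    linarith [clampUnit_nonneg (u x - n), clampUnit_le_one (u x - (0 : ℕ))]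
  · simp only [BoundedContinuousFunction.coe_ofNormedAddCommGroup]
    rw [Fin.sum_univ_eq_sum_range
      (fun k => clampUnit (u x - k) - clampUnit (u x - (k + 1 : ℕ))) n, Finset.sum_range_sub'
      (fun k => clampUnit (u x - (k : ℕ)))]
    obtain ⟨h1, h2⟩ := abs_le.1 hx
    rw [clampUnit_of_one_le, clampUnit_of_nonpos, sub_zero]
    · have : (x + R) / (η / 2) ≤ 2 * R / (η / 2) := by gcongr; linarith
      simp only [hu]; linarith
    · have : 0 ≤ (x + R) / (η / 2) := div_nonneg (by linarith) (by linarith)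
      simp only [hu]; push_cast; linarith
  · have key : ∀ x, clampUnit (u x - k) - clampUnit (u x - (k + 1 : ℕ)) ≠ 0 →
        (k : ℝ) - 1 < (x + R) / (η / 2) ∧ (x + R) / (η / 2) < k + 1 := by
      intro x hx
      constructor
      · by_contra! h
        refine hx ?_
        rw [clampUnit_of_nonpos, clampUnit_of_nonpos, sub_zero] <;>
        · simp only [hu]; push_cast; linarith
      · by_contra! h
        refine hx ?_
        rw [clampUnit_of_one_le, clampUnit_of_one_le, sub_self] <;>
        · simp only [hu]; push_cast; linarith
    obtain ⟨hx₁, hx₂⟩ := key x hx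
    obtain ⟨hy₁, hy₂⟩ := key y hy
    have hη' : (0 : ℝ) < η / 2 := by linarith
    rw [lt_div_iff₀ hη'] at hx₁ hy₁
    rw [div_lt_iff₀ hη'] at hx₂ hy₂
    rw [abs_le]
    constructor <;> nlinarith

end Partition

/-! ### From weak convergence in probability to the Wasserstein distance -/

section WeakConvergence

variable {Ω : ℕ → Type*} [∀ N, MeasurableSpace (Ω N)] {P : ∀ N, Measure (Ω N)}
  [∀ N, IsProbabilityMeasure (P N)]

lemma tendsto_lintegral_abs_of_bounded {Y : ∀ N, Ω N → ℝ} {C : ℝ}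
    (hC : ∀ᶠ N in atTop, ∀ ω, |Y N ω| ≤ C)
    (hY : ∀ ε : ℝ, 0 < ε → Tendsto (fun N => P N {ω | ε ≤ |Y N ω|}) atTop (𝓝 0)) :
    Tendsto (fun N => ∫⁻ ω, ENNReal.ofReal |Y N ω| ∂(P N)) atTop (𝓝 0) := by
  rw [ENNReal.tendsto_nhds_zero]
  intro ε hε
  obtain ⟨d, hd₀, hd⟩ := ENNReal.lt_iff_exists_nnreal_btwn.1 hε
  have hlim : Tendsto (fun N => (d : ℝ≥0∞) + ENNReal.ofReal C * P N {ω | (d : ℝ) ≤ |Y N ω|}) atTop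
      (𝓝 (d + ENNReal.ofReal C * 0)) :=
    tendsto_const_nhds.add (ENNReal.Tendsto.const_mul (hY d (by exact_mod_cast hd₀))
      (Or.inr ENNReal.ofReal_ne_top))
  filter_upwards [hC, hlim.eventually_lt_const (by simpa using hd)] with N hN h
  refine le_trans ?_ h.le
  calc ∫⁻ ω, ENNReal.ofReal |Y N ω| ∂(P N)
      ≤ ∫⁻ ω, (d + {ω | (d : ℝ) ≤ |Y N ω|}.indicator (fun _ => ENNReal.ofReal C) ω) ∂(P N) := by
        refine lintegral_mono fun ω => ?_
        by_cases hω : (d : ℝ) ≤ |Y N ω|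
        · rw [Set.indicator_of_mem (by exact hω)]
          exact (ENNReal.ofReal_le_ofReal (hN ω)).trans le_add_self
        · rw [Set.indicator_of_notMem (by exact hω), add_zero]
          exact ENNReal.ofReal_le_of_le_toReal (by simpa using (not_le.1 hω).le)
    _ ≤ _ := by
        rw [lintegral_add_left measurable_const, lintegral_const, measure_univ, mul_one]
        gcongr
        exact lintegral_indicator_const_le _ _

lemma lintegral_empiricalMeasure_enorm_pow_four {N : ℕ} (hN : 1 ≤ N)
    (x : EuclideanSpace ℝ (Fin N)) :
    ∫⁻ y, ‖y‖ₑ ^ 4 ∂(empiricalMeasure x) = ENNReal.ofReal ((1 / (N : ℝ)) * ∑ i, |x i| ^ 4) := by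
  have hN' : (0 : ℝ) < N := by exact_mod_cast hN
  rw [lintegral_empiricalMeasure, ENNReal.ofReal_mul (by positivity), one_div,
    ENNReal.ofReal_inv_of_pos hN', ENNReal.ofReal_natCast,
    ENNReal.ofReal_sum_of_nonneg (fun i _ => by positivity)]
  simp [ENNReal.ofReal_pow, ← Real.enorm_eq_ofReal_abs]

variable {x : ∀ N, Ω N → EuclideanSpace ℝ (Fin N)} {ρ : Measure ℝ} [IsProbabilityMeasure ρ]

lemma tendsto_lintegral_abs_integral_sub
    (hweak : ∀ f : ℝ →ᵇ ℝ, ∀ ε : ℝ, 0 < ε → Tendsto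
      (fun N => P N {ω | ε ≤ |∫ y, f y ∂(empiricalMeasure (x N ω)) - ∫ y, f y ∂ρ|}) atTop (𝓝 0))
    (f : ℝ →ᵇ ℝ) :
    Tendsto (fun N => ∫⁻ ω, ENNReal.ofReal
      |∫ y, f y ∂(empiricalMeasure (x N ω)) - ∫ y, f y ∂ρ| ∂(P N)) atTop (𝓝 0) := by
  refine tendsto_lintegral_abs_of_bounded (C := ‖f‖ + ‖f‖) ?_ (hweak f)
  filter_upwards [eventually_ge_atTop 1] with N hN ω
  have := isProbabilityMeasure_empiricalMeasure hN (x N ω)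
  exact (abs_sub _ _).trans (add_le_add (f.norm_integral_le_norm _) (f.norm_integral_le_norm _))

lemma measurable_integral_empiricalMeasure {N : ℕ} (hx : Measurable (x N)) (f : ℝ →ᵇ ℝ) :
    Measurable fun ω => ∫ y, f y ∂(empiricalMeasure (x N ω)) := by
  simp only [integral_empiricalMeasure]
  have := f.continuous.measurable
  fun_prop

/-- Fatou's lemma for weak convergence in probability: a bound on the expected fourth moments of
the empirical measures passes to the limit. -/
lemma lintegral_enorm_pow_four_le_of_weak (hx : ∀ N, 1 ≤ N → Measurable (x N))
    (hweak : ∀ f : ℝ →ᵇ ℝ, ∀ ε : ℝ, 0 < ε → Tendsto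
      (fun N => P N {ω | ε ≤ |∫ y, f y ∂(empiricalMeasure (x N ω)) - ∫ y, f y ∂ρ|}) atTop (𝓝 0))
    {C : ℝ≥0∞} (hC : ∀ N : ℕ, 1 ≤ N →
      ∫⁻ ω, ∫⁻ y, ‖y‖ₑ ^ 4 ∂(empiricalMeasure (x N ω)) ∂(P N) ≤ C) :
    ∫⁻ y, ‖y‖ₑ ^ 4 ∂ρ ≤ C := by
  have hcont : ∀ n : ℕ, Continuous fun y : ℝ => min (|y| ^ 4) (n : ℝ) := fun n => by fun_prop
  have hnn : ∀ (n : ℕ) (y : ℝ), 0 ≤ min (|y| ^ 4) (n : ℝ) := fun n y => by positivity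
  let f : ℕ → ℝ →ᵇ ℝ := fun n => BoundedContinuousFunction.ofNormedAddCommGroup _ (hcont n) n
    fun y => by rw [Real.norm_of_nonneg (hnn n y)]; exact min_le_right _ _
  have htrunc : ∀ (κ : Measure ℝ) [IsProbabilityMeasure κ] n,
      ENNReal.ofReal (∫ y, f n y ∂κ) = ∫⁻ y, ENNReal.ofReal (f n y) ∂κ := fun κ _ n =>
    ofReal_integral_eq_lintegral_ofReal ((f n).integrable κ) (ae_of_all _ (hnn n))
  have hle : ∀ n y, ENNReal.ofReal (f n y) ≤ ‖y‖ₑ ^ 4 := fun n y => by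
    rw [Real.enorm_eq_ofReal_abs, ← ENNReal.ofReal_pow (abs_nonneg y)]
    exact ENNReal.ofReal_le_ofReal (min_le_left _ _)
  have hbound : ∀ n, ∫⁻ y, ENNReal.ofReal (f n y) ∂ρ ≤ C := by
    intro n
    have hlim := (tendsto_const_nhds (x := C)).add (tendsto_lintegral_abs_integral_sub hweak (f n))
    rw [add_zero] at hlim
    refine ge_of_tendsto hlim ?_
    filter_upwards [eventually_ge_atTop 1] with N hN
    rw [← htrunc]
    calc ENNReal.ofReal (∫ y, f n y ∂ρ) = ∫⁻ _, ENNReal.ofReal (∫ y, f n y ∂ρ) ∂(P N) := by simp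
      _ ≤ ∫⁻ ω, (ENNReal.ofReal (∫ y, f n y ∂(empiricalMeasure (x N ω))) + ENNReal.ofReal
            |∫ y, f n y ∂(empiricalMeasure (x N ω)) - ∫ y, f n y ∂ρ|) ∂(P N) := by
          refine lintegral_mono fun ω => ?_
          have h₀ : 0 ≤ ∫ y, f n y ∂(empiricalMeasure (x N ω)) := integral_nonneg (hnn n)
          rw [← ENNReal.ofReal_add h₀ (abs_nonneg _)]
          refine ENNReal.ofReal_le_ofReal ?_
          linarith [neg_abs_le (∫ y, f n y ∂(empiricalMeasure (x N ω)) - ∫ y, f n y ∂ρ)]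
      _ ≤ _ := by
          rw [lintegral_add_left
            (measurable_integral_empiricalMeasure (hx N hN) (f n)).ennreal_ofReal]
          gcongr
          refine le_trans (lintegral_mono fun ω => ?_) (hC N hN)
          have := isProbabilityMeasure_empiricalMeasure hN (x N ω)
          dsimp only
          rw [htrunc]
          exact lintegral_mono (hle n)
  have hlim : ∀ y : ℝ, liminf (fun n => ENNReal.ofReal (f n y)) atTop = ‖y‖ₑ ^ 4 := by
    intro y
    refine Tendsto.liminf_eq (tendsto_const_nhds.congr' ?_)
    obtain ⟨n₀, hn₀⟩ := exists_nat_ge (|y| ^ 4)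
    filter_upwards [eventually_ge_atTop n₀] with n hn
    have : |y| ^ 4 ≤ n := hn₀.trans (by exact_mod_cast hn)
    change _ = ENNReal.ofReal (min (|y| ^ 4) n)
    rw [min_eq_left this, Real.enorm_eq_ofReal_abs, ENNReal.ofReal_pow (abs_nonneg y)]
  calc ∫⁻ y, ‖y‖ₑ ^ 4 ∂ρ = ∫⁻ y, liminf (fun n => ENNReal.ofReal (f n y)) atTop ∂ρ := by
        simp only [hlim]
    _ ≤ liminf (fun n => ∫⁻ y, ENNReal.ofReal (f n y) ∂ρ) atTop :=
        lintegral_liminf_le fun n => ((f n).continuous.measurable).ennreal_ofReal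
    _ ≤ C := by
        refine liminf_le_of_le (by isBoundedDefault) fun b hb => ?_
        obtain ⟨n, hn⟩ := hb.exists
        exact hn.trans (hbound n)

/-- Weak convergence in probability together with bounded fourth moments gives convergence of
the expected `W2` distance. -/
lemma tendsto_lintegral_W2_of_weak (hx : ∀ N, 1 ≤ N → Measurable (x N))
    (hweak : ∀ f : ℝ →ᵇ ℝ, ∀ ε : ℝ, 0 < ε → Tendsto
      (fun N => P N {ω | ε ≤ |∫ y, f y ∂(empiricalMeasure (x N ω)) - ∫ y, f y ∂ρ|}) atTop (𝓝 0))
    {C : ℝ≥0∞} (hCtop : C ≠ ∞) (hC : ∀ N : ℕ, 1 ≤ N →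
      ∫⁻ ω, ∫⁻ y, ‖y‖ₑ ^ 4 ∂(empiricalMeasure (x N ω)) ∂(P N) ≤ C) :
    Tendsto (fun N => ∫⁻ ω, W2 (empiricalMeasure (x N ω)) ρ ∂(P N)) atTop (𝓝 0) := by
  have hρ := lintegral_enorm_pow_four_le_of_weak hx hweak hC
  have hmeas : ∀ N, 1 ≤ N → Measurable fun ω => W2 (empiricalMeasure (x N ω)) ρ := fun N hN =>
    (continuous_W2_empiricalMeasure hN ρ).measurable.comp (hx N hN)
  -- It suffices to control the second moment of the distance.
  suffices H : Tendsto (fun N => ∫⁻ ω, W2 (empiricalMeasure (x N ω)) ρ ^ 2 ∂(P N)) atTop (𝓝 0) by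
    have H' := ((ENNReal.continuous_rpow_const (y := (1 / 2 : ℝ))).tendsto 0).comp H
    rw [ENNReal.zero_rpow_of_pos (by norm_num)] at H'
    refine tendsto_of_tendsto_of_tendsto_of_le_of_le' tendsto_const_nhds H'
      (Eventually.of_forall fun _ => zero_le) ?_
    filter_upwards [eventually_ge_atTop 1] with N hN
    exact lintegral_le_sqrt_lintegral_sq _ (hmeas N hN).aemeasurable
  rw [ENNReal.tendsto_nhds_zero]
  intro ε hε
  -- Cells of diameter `1 / n` covering `[-n, n]`, and the truncation level `L = n`.
  obtain ⟨n, hn₁, hn⟩ : ∃ n : ℕ, 1 ≤ n ∧ (n : ℝ≥0∞)⁻¹ * (1 + 8 * C) < ε := by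
    have h : Tendsto (fun n : ℕ => (n : ℝ≥0∞)⁻¹ * (1 + 8 * C)) atTop (𝓝 (0 * (1 + 8 * C))) :=
      ENNReal.Tendsto.mul_const ENNReal.tendsto_inv_nat_nhds_zero (Or.inr (by finiteness))
    rw [zero_mul] at h
    exact ((eventually_ge_atTop 1).and (h.eventually_lt_const hε)).exists
  have hn₀ : (n : ℝ≥0∞) ≠ 0 := by exact_mod_cast (by omega : n ≠ 0)
  have hnR : (0 : ℝ) < n := by exact_mod_cast hn₁
  have hninv : (n : ℝ≥0∞)⁻¹ ≤ 1 := ENNReal.inv_le_one.2 (by exact_mod_cast hn₁)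
  obtain ⟨q, f, hf₀, hf₁, hfR, hfη⟩ := exists_continuous_partition (η := (n : ℝ)⁻¹) (R := n)
    (by positivity)
  set φ : Fin q → ℝ → ℝ≥0∞ := fun k y => ENNReal.ofReal (f k y) with hφ
  have hφm : ∀ k, Measurable (φ k) := fun k => (f k).continuous.measurable.ennreal_ofReal
  have hφsum : ∀ y, ∑ k, φ k y = ENNReal.ofReal (∑ k, f k y) := fun y =>
    (ENNReal.ofReal_sum_of_nonneg fun k _ => hf₀ k y).symm
  have hφ₁ : ∀ y, ∑ k, φ k y ≤ 1 := fun y => by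
    rw [hφsum]; exact ENNReal.ofReal_le_one.2 (hf₁ y)
  have hφη : ∀ k y z, φ k y ≠ 0 → φ k z ≠ 0 → edist y z ≤ (n : ℝ≥0∞)⁻¹ := by
    intro k y z hy hz
    rw [edist_dist, Real.dist_eq, ← ENNReal.ofReal_natCast, ← ENNReal.ofReal_inv_of_pos hnR]
    refine ENNReal.ofReal_le_ofReal (hfη k y z (fun h => hy ?_) (fun h => hz ?_)) <;> simp [hφ, h]
  have hφint : ∀ (κ : Measure ℝ) [IsProbabilityMeasure κ] k,
      ∫⁻ y, φ k y ∂κ = ENNReal.ofReal (∫ y, f k y ∂κ) := fun κ _ k =>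
    (ofReal_integral_eq_lintegral_ofReal ((f k).integrable κ) (ae_of_all _ (hf₀ k))).symm
  -- Markov's inequality: `ρ` charges little outside of `[-n, n]`.
  have htail : 1 ≤ ∑ k, ∫⁻ y, φ k y ∂ρ + (n : ℝ≥0∞)⁻¹ ^ 4 * C := by
    calc 1 = ∫⁻ _, 1 ∂ρ := by simp
      _ ≤ ∫⁻ y, (∑ k, φ k y + (n : ℝ≥0∞)⁻¹ ^ 4 * ‖y‖ₑ ^ 4) ∂ρ := by
          refine lintegral_mono fun y => ?_
          rcases le_total |y| n with h | h
          · simp [hφsum, hfR y h]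
          · refine le_trans ?_ le_add_self
            rw [← mul_pow]
            refine one_le_pow₀ ?_
            rw [Real.enorm_eq_ofReal_abs, mul_comm, ← div_eq_mul_inv,
              ENNReal.le_div_iff_mul_le (Or.inl hn₀) (Or.inl (by simp)), one_mul,
              ← ENNReal.ofReal_natCast]
            exact ENNReal.ofReal_le_ofReal h
      _ = ∑ k, ∫⁻ y, φ k y ∂ρ + (n : ℝ≥0∞)⁻¹ ^ 4 * ∫⁻ y, ‖y‖ₑ ^ 4 ∂ρ := by
          rw [lintegral_add_right _ (by fun_prop), lintegral_finsetSum _ (fun k _ => hφm k),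
            lintegral_const_mul _ (by fun_prop)]
      _ ≤ _ := by gcongr
  set D : Fin q → ∀ N, Ω N → ℝ≥0∞ := fun k N ω => ENNReal.ofReal
    |∫ y, f k y ∂(empiricalMeasure (x N ω)) - ∫ y, f k y ∂ρ| with hD
  have hDm : ∀ k N, 1 ≤ N → Measurable (D k N) := fun k N hN => by
    have := measurable_integral_empiricalMeasure (hx N hN) (f k)
    simp only [hD]
    fun_prop
  have hmain : ∀ N, 1 ≤ N → ∫⁻ ω, W2 (empiricalMeasure (x N ω)) ρ ^ 2 ∂(P N) ≤
      (n : ℝ≥0∞)⁻¹ ^ 2 + 4 * n * ((n : ℝ≥0∞)⁻¹ ^ 4 * C + ∑ k, ∫⁻ ω, D k N ω ∂(P N))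
        + 2 * (n : ℝ≥0∞)⁻¹ * (C + C) := by
    intro N hN
    have hM : Measurable fun ω => ∫⁻ y, ‖y‖ₑ ^ 4 ∂(empiricalMeasure (x N ω)) := by
      have := hx N hN
      simp only [lintegral_empiricalMeasure]
      fun_prop
    calc ∫⁻ ω, W2 (empiricalMeasure (x N ω)) ρ ^ 2 ∂(P N)
        ≤ ∫⁻ ω, ((n : ℝ≥0∞)⁻¹ ^ 2 + 4 * n * ((n : ℝ≥0∞)⁻¹ ^ 4 * C + ∑ k, D k N ω)
            + 2 * (n : ℝ≥0∞)⁻¹ * (∫⁻ y, ‖y‖ₑ ^ 4 ∂(empiricalMeasure (x N ω)) + C)) ∂(P N) := by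
          refine lintegral_mono fun ω => ?_
          have := isProbabilityMeasure_empiricalMeasure hN (x N ω)
          refine (W2_sq_le_of_partition _ ρ hφm hφ₁ hφη hn₀ (by simp)).trans ?_
          gcongr
          rw [tsub_le_iff_right]
          calc 1 ≤ ∑ k, ∫⁻ y, φ k y ∂ρ + (n : ℝ≥0∞)⁻¹ ^ 4 * C := htail
            _ ≤ ∑ k, (D k N ω + min (∫⁻ y, φ k y ∂(empiricalMeasure (x N ω)))
                  (∫⁻ y, φ k y ∂ρ)) + (n : ℝ≥0∞)⁻¹ ^ 4 * C := by
                gcongr with k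
                rw [min_comm]
                conv_lhs => rw [← tsub_add_min (a := ∫⁻ y, φ k y ∂ρ)
                  (b := ∫⁻ y, φ k y ∂(empiricalMeasure (x N ω)))]
                gcongr
                rw [hφint, hφint, ← ENNReal.ofReal_sub _ (integral_nonneg (hf₀ k))]
                refine ENNReal.ofReal_le_ofReal ?_
                rw [abs_sub_comm]
                exact le_abs_self _
            _ = _ := by rw [Finset.sum_add_distrib]; ring
      _ = (n : ℝ≥0∞)⁻¹ ^ 2 + 4 * n * ((n : ℝ≥0∞)⁻¹ ^ 4 * C + ∑ k, ∫⁻ ω, D k N ω ∂(P N))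
            + 2 * (n : ℝ≥0∞)⁻¹ *
              (∫⁻ ω, ∫⁻ y, ‖y‖ₑ ^ 4 ∂(empiricalMeasure (x N ω)) ∂(P N) + C) := by
          have hS : Measurable fun ω => ∑ k, D k N ω :=
            Finset.measurable_fun_sum _ fun k _ => hDm k N hN
          rw [lintegral_add_right _ (by fun_prop), lintegral_add_left measurable_const,
            lintegral_const_mul _ (by fun_prop), lintegral_add_left measurable_const,
            lintegral_finsetSum _ (fun k _ => hDm k N hN),
            lintegral_const_mul (2 * (n : ℝ≥0∞)⁻¹) (by fun_prop),
            lintegral_add_right _ measurable_const]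
          simp
      _ ≤ _ := by
          gcongr
          exact hC N hN
  have hlim : Tendsto (fun N => (n : ℝ≥0∞)⁻¹ ^ 2
      + 4 * n * ((n : ℝ≥0∞)⁻¹ ^ 4 * C + ∑ k, ∫⁻ ω, D k N ω ∂(P N))
        + 2 * (n : ℝ≥0∞)⁻¹ * (C + C)) atTop (𝓝 ((n : ℝ≥0∞)⁻¹ ^ 2
      + 4 * n * ((n : ℝ≥0∞)⁻¹ ^ 4 * C + ∑ _k : Fin q, 0) + 2 * (n : ℝ≥0∞)⁻¹ * (C + C))) := by
    refine (tendsto_const_nhds.add (ENNReal.Tendsto.const_mul (tendsto_const_nhds.add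
      (tendsto_finsetSum _ fun k _ => tendsto_lintegral_abs_integral_sub hweak (f k)))
      (Or.inr (by finiteness)))).add tendsto_const_nhds
  have hval : (n : ℝ≥0∞)⁻¹ ^ 2
      + 4 * n * ((n : ℝ≥0∞)⁻¹ ^ 4 * C + ∑ _k : Fin q, 0) + 2 * (n : ℝ≥0∞)⁻¹ * (C + C) < ε := by
    refine lt_of_le_of_lt ?_ hn
    calc _ = (n : ℝ≥0∞)⁻¹ * ((n : ℝ≥0∞)⁻¹ + 4 * ((n : ℝ≥0∞)⁻¹ ^ 2 * ((n : ℝ≥0∞)⁻¹ * n)) * C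
          + 4 * C) := by
          rw [Finset.sum_const_zero]; ring
      _ ≤ (n : ℝ≥0∞)⁻¹ * (1 + 4 * (1 ^ 2 * 1) * C + 4 * C) := by
          rw [ENNReal.inv_mul_cancel hn₀ (by simp)]
          gcongr
      _ = _ := by ring
  filter_upwards [eventually_ge_atTop 1, hlim.eventually_lt_const hval] with N hN h
  exact (hmain N hN).trans h.le

end WeakConvergence

/-! ### Restarting a solution -/

section Shift

/-- The filtration seen from time `s` on. -/
def shiftFiltration {Ω : Type*} {mΩ : MeasurableSpace Ω} (F : Filtration ℝ≥0 mΩ) (s : ℝ≥0) :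
    Filtration ℝ≥0 mΩ where
  seq t := F (s + t)
  mono' _ _ h := F.mono (by gcongr)
  le' t := F.le (s + t)

variable {Ω : Type*} {mΩ : MeasurableSpace Ω} {N : ℕ} {U V : ℝ → ℝ} {σ : ℝ≥0}
  {D : Set (EuclideanSpace ℝ (Fin N))} {P : Measure Ω} {F : Filtration ℝ≥0 mΩ}
  {B : Fin N → ℝ≥0 → Ω → ℝ} {X : ℝ≥0 → Ω → EuclideanSpace ℝ (Fin N)}

lemma IsBrownianFamily.shift (h : IsBrownianFamily P F B) (s : ℝ≥0) :
    IsBrownianFamily P (shiftFiltration F s) fun i t ω => B i (s + t) ω - B i s ω where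
  brownian i := (h.brownian i).shift s
  indep := h.indep.comp (fun _ (b : ℝ≥0 → ℝ) t => b (s + t) - b s) fun _ => by fun_prop
  adapted i t := (h.adapted i (s + t)).sub ((h.adapted i s).mono (F.mono le_self_add) le_rfl)
  indep_increments r t hrt := by
    simp only [sub_sub_sub_cancel_right]
    exact h.indep_increments (s + r) (s + t) (by gcongr)

/-- The equation is autonomous: a solution restarted at time `s` is again a solution, driven by
the increments of the Brownian motions after time `s`. -/
lemma IsSolution.shift (h : IsSolution U V σ D P F B X) (s : ℝ≥0) :
    IsSolution U V σ D P (shiftFiltration F s) (fun i t ω => B i (s + t) ω - B i s ω)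
      fun t => X (s + t) := by
  have htime : ∀ (ω : Ω) (i : Fin N) (t : ℝ≥0), Set.EqOn
      (fun r : ℝ => drift U V (X ((s : ℝ) + r).toNNReal ω) i)
      (fun r : ℝ => drift U V (X (s + r.toNNReal) ω) i) (Set.uIcc 0 (t : ℝ)) := by
    intro ω i t r hr
    rw [Set.uIcc_of_le t.coe_nonneg] at hr
    dsimp only
    rw [Real.toNNReal_add s.coe_nonneg hr.1, Real.toNNReal_coe]
  refine ⟨h.isBrownianFamily.shift s, fun t => h.adapted (s + t), ?_, fun t => h.mem_state (s + t),
    ?_, ?_⟩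
  · filter_upwards [h.continuous_paths] with ω hω
    exact hω.comp (by fun_prop)
  · filter_upwards [h.integrable_drift] with ω hω i t
    have h1 : IntervalIntegrable (fun r : ℝ => drift U V (X r.toNNReal ω) i) volume s
        ((s + t : ℝ≥0) : ℝ) := (hω i s).symm.trans (hω i (s + t))
    have h2 := h1.comp_add_left (s : ℝ)
    simp only [sub_self, NNReal.coe_add, add_sub_cancel_left] at h2
    exact h2.congr ((htime ω i t).mono Set.uIoc_subset_uIcc)
  · filter_upwards [h.equation, h.integrable_drift] with ω hω hint i t
    have h1 := hω i (s + t)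
    have h2 := hω i s
    have h3 : ∫ r in (0 : ℝ)..t, drift U V (X (s + r.toNNReal) ω) i
        = ∫ r in (s : ℝ)..((s + t : ℝ≥0) : ℝ), drift U V (X r.toNNReal ω) i := by
      rw [← intervalIntegral.integral_congr (htime ω i t),
        intervalIntegral.integral_comp_add_left
          (fun r : ℝ => drift U V (X r.toNNReal ω) i) (s : ℝ)]
      simp
    have h4 := intervalIntegral.integral_add_adjacent_intervals (hint i s)
      ((hint i s).symm.trans (hint i (s + t)))
    rw [add_zero, h3]
    linarith

end Shift

/-! ### Displacement between two times -/

section Contraction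

lemma edist_sq_eq {N : ℕ} (x y : EuclideanSpace ℝ (Fin N)) :
    edist x y ^ 2 = ENNReal.ofReal (∑ i, |x i - y i| ^ 2) := by
  rw [EuclideanSpace.edist_eq, ← ENNReal.rpow_two, ← ENNReal.rpow_mul,
    ENNReal.ofReal_sum_of_nonneg (fun i _ => by positivity)]
  norm_num
  refine Finset.sum_congr rfl fun i _ => ?_
  rw [← sq_abs, ENNReal.ofReal_pow (abs_nonneg _), edist_dist, Real.dist_eq]

/-- The `W2` distance of the laws of two configurations, in the normalization of the particle
average, is bounded by their mean square displacement. -/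
lemma inv_sqrt_mul_W2_map_le {Ω : Type*} [MeasurableSpace Ω] {P : Measure Ω} {N : ℕ}
    (hN : 1 ≤ N) {x y : Ω → EuclideanSpace ℝ (Fin N)} (hx : Measurable x) (hy : Measurable y) :
    ((N : ℝ≥0∞)⁻¹) ^ (1 / 2 : ℝ) * W2 (P.map x) (P.map y) ≤
      (∫⁻ ω, ENNReal.ofReal ((1 / (N : ℝ)) * ∑ i, |y ω i - x ω i| ^ 2) ∂P) ^ (1 / 2 : ℝ) := by
  have hN' : (0 : ℝ) < N := by exact_mod_cast hN
  have hxy : Measurable fun ω => (x ω, y ω) := hx.prodMk hy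
  calc _ ≤ ((N : ℝ≥0∞)⁻¹) ^ (1 / 2 : ℝ) *
        (∫⁻ z, edist z.1 z.2 ^ 2 ∂(P.map fun ω => (x ω, y ω))) ^ (1 / 2 : ℝ) := by
        gcongr
        refine W2_le_of_coupling ?_ ?_
        · rw [Measure.map_map measurable_fst hxy]; rfl
        · rw [Measure.map_map measurable_snd hxy]; rfl
    _ = _ := by
        rw [lintegral_map (by fun_prop) hxy, ← ENNReal.mul_rpow_of_nonneg _ _ (by norm_num),
          ← lintegral_const_mul _ (by fun_prop)]
        congr 2 with ω
        rw [edist_comm, edist_sq_eq, ENNReal.ofReal_mul (by positivity), one_div,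
          ENNReal.ofReal_inv_of_pos hN', ENNReal.ofReal_natCast]

lemma mean_sq_sub_le {N : ℕ} (hN : 1 ≤ N) (x y : EuclideanSpace ℝ (Fin N)) :
    (1 / (N : ℝ)) * ∑ i, |x i - y i| ^ 2 ≤
      4 + 2 * ((1 / (N : ℝ)) * ∑ i, |x i| ^ 4) + 2 * ((1 / (N : ℝ)) * ∑ i, |y i| ^ 4) := by
  have hN' : (0 : ℝ) < N := by exact_mod_cast hN
  have h1 : ∑ i, |x i - y i| ^ 2 ≤ ∑ i, (4 + 2 * |x i| ^ 4 + 2 * |y i| ^ 4) := by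
    refine Finset.sum_le_sum fun i _ => ?_
    rw [sq_abs, Even.pow_abs (by decide : Even 4), Even.pow_abs (by decide : Even 4)]
    nlinarith [sq_nonneg (x i + y i), sq_nonneg (x i ^ 2 - 1), sq_nonneg (y i ^ 2 - 1)]
  calc _ ≤ (1 / (N : ℝ)) * ∑ i, (4 + 2 * |x i| ^ 4 + 2 * |y i| ^ 4) := by gcongr
    _ = _ := by
      rw [Finset.sum_add_distrib, Finset.sum_add_distrib, ← Finset.mul_sum, ← Finset.mul_sum]
      simp only [Finset.sum_const, Finset.card_univ, Fintype.card_fin, nsmul_eq_mul]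
      field_simp

variable {Ω : ℕ → Type*} [∀ N, MeasurableSpace (Ω N)] {P : ∀ N, Measure (Ω N)}
  [∀ N, IsProbabilityMeasure (P N)] {X : ∀ N, ℝ≥0 → Ω N → EuclideanSpace ℝ (Fin N)}

lemma lintegral_mean_sq_sub_le {N : ℕ} (hN : 1 ≤ N) {t : ℝ≥0} (hXm : ∀ t, Measurable (X N t))
    {C₀ : ℝ} (hC₀ : 0 ≤ C₀)
    (hC : ∀ t : ℝ≥0, ∫⁻ ω, ENNReal.ofReal ((1 / (N : ℝ)) * ∑ i, |X N t ω i| ^ 4) ∂(P N)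
      ≤ ENNReal.ofReal C₀) :
    ∫⁻ ω, ENNReal.ofReal ((1 / (N : ℝ)) * ∑ i, |X N t ω i - X N 0 ω i| ^ 2) ∂(P N)
      ≤ ENNReal.ofReal (4 + 4 * C₀) := by
  have hmeas : ∀ t, Measurable fun ω =>
      ENNReal.ofReal ((1 / (N : ℝ)) * ∑ i, |X N t ω i| ^ 4) := fun t => by
    have := hXm t
    fun_prop
  calc _ ≤ ∫⁻ ω, (4 + 2 * ENNReal.ofReal ((1 / (N : ℝ)) * ∑ i, |X N t ω i| ^ 4)
        + 2 * ENNReal.ofReal ((1 / (N : ℝ)) * ∑ i, |X N 0 ω i| ^ 4)) ∂(P N) := by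
        refine lintegral_mono fun ω => ?_
        refine (ENNReal.ofReal_le_ofReal (mean_sq_sub_le hN _ _)).trans_eq ?_
        rw [ENNReal.ofReal_add (by positivity) (by positivity),
          ENNReal.ofReal_add (by positivity) (by positivity), ENNReal.ofReal_mul (by norm_num),
          ENNReal.ofReal_mul (by norm_num)]
        simp
    _ ≤ 4 + 2 * ENNReal.ofReal C₀ + 2 * ENNReal.ofReal C₀ := by
        have := hmeas t
        have := hmeas 0
        rw [lintegral_add_right _ (by fun_prop), lintegral_add_left measurable_const,
          lintegral_const_mul _ (hmeas t), lintegral_const_mul _ (hmeas 0), lintegral_const,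
          measure_univ, mul_one]
        gcongr
        · exact hC t
        · exact hC 0
    _ = ENNReal.ofReal (4 + 4 * C₀) := by
        rw [ENNReal.ofReal_add (by norm_num) (by positivity), ENNReal.ofReal_mul (by norm_num)]
        norm_num
        ring

variable {ρ : ℝ≥0 → ProbabilityMeasure ℝ}

/-- The error of the mean-field limit at time `s` controls the error at any later time, up to the
displacement of the system between the two times. The limit inherits from the particle system the
bound on this displacement, which is the reason for the factor `2`. -/
lemma lintegral_W2_le_add_displacement (hXm : ∀ N, 1 ≤ N → ∀ t, Measurable (X N t))
    (hlim : ∀ t, Tendsto (fun N => ∫⁻ ω, W2 (empiricalMeasure (X N t ω)) (ρ t : Measure ℝ) ∂(P N))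
      atTop (𝓝 0)) {s t : ℝ≥0} {d : ℝ≥0∞}
    (hd : ∀ N : ℕ, 1 ≤ N →
      ((N : ℝ≥0∞)⁻¹) ^ (1 / 2 : ℝ) * W2 ((P N).map (X N s)) ((P N).map (X N t)) ≤ d)
    {N : ℕ} (hN : 1 ≤ N) :
    ∫⁻ ω, W2 (empiricalMeasure (X N t ω)) (ρ t : Measure ℝ) ∂(P N) ≤
      ∫⁻ ω, W2 (empiricalMeasure (X N s ω)) (ρ s : Measure ℝ) ∂(P N) + 2 * d := by
  have hmap : ∀ N, 1 ≤ N → ∀ t,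
      ∫⁻ y, W2 (empiricalMeasure y) (ρ t : Measure ℝ) ∂((P N).map (X N t))
        = ∫⁻ ω, W2 (empiricalMeasure (X N t ω)) (ρ t : Measure ℝ) ∂(P N) := fun N hN t =>
    lintegral_map (continuous_W2_empiricalMeasure hN _).measurable (hXm N hN t)
  have hprob : ∀ N, 1 ≤ N → ∀ t, IsProbabilityMeasure ((P N).map (X N t)) := fun N hN t =>
    Measure.isProbabilityMeasure_map (hXm N hN t).aemeasurable
  have hρ : W2 (ρ s : Measure ℝ) (ρ t) ≤ d := by
    have h := ((hlim s).add (hlim t)).add (tendsto_const_nhds (x := d))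
    rw [add_zero, zero_add] at h
    refine ge_of_tendsto h ?_
    filter_upwards [eventually_ge_atTop 1] with M hM
    have := hprob M hM s
    refine (W2_le_lintegral_W2_empiricalMeasure hM ((P M).map (X M s)) ((P M).map (X M t))
      _ _).trans ?_
    rw [hmap M hM, hmap M hM]
    gcongr
    exact hd M hM
  have := hprob N hN s
  rw [← hmap N hN t, ← hmap N hN s, two_mul, ← add_assoc]
  refine (lintegral_W2_empiricalMeasure_le hN ((P N).map (X N s)) ((P N).map (X N t))
    (ρ s : Measure ℝ) (ρ t)).trans ?_
  gcongr
  exact hd N hN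

end Contraction

end ParticleChaos

/-! ### Uniformity in time -/

theorem theorem5p1
    (U V : ℝ → ℝ) (σ : ℕ → ℝ≥0) (D : ∀ N : ℕ, Set (EuclideanSpace ℝ (Fin N)))
    (Ω : ℕ → Type u) [mΩ : ∀ N, MeasurableSpace (Ω N)]
    (P : ∀ N, Measure (Ω N)) [∀ N, IsProbabilityMeasure (P N)]
    (F : ∀ N, Filtration ℝ≥0 (mΩ N)) (B : ∀ N, Fin N → ℝ≥0 → Ω N → ℝ)
    (X : ∀ N, ℝ≥0 → Ω N → EuclideanSpace ℝ (Fin N)) (ρ : ℝ≥0 → ProbabilityMeasure ℝ)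
    (hX : ∀ N : ℕ, 1 ≤ N →
      ParticleChaos.IsSolution U V (σ N) (D N) (P N) (F N) (B N) (X N))
    (hweak : ParticleChaos.WeakPropagationOfChaos P X ρ)
    (hmoments : ParticleChaos.BoundedFourthMoments P X)
    (hlong : ParticleChaos.LongTimeConvergence.{u} U V σ D)
    (hcont : ParticleChaos.UniformContinuityAtZero P X) :
    ∀ ε : ℝ, 0 < ε → ∃ N : ℕ, ∀ t : ℝ≥0, ∀ n : ℕ, N ≤ n →
      ∫⁻ ω, ParticleChaos.W2 (ParticleChaos.empiricalMeasure (X n t ω)) (ρ t : Measure ℝ) ∂(P n)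
        < ENNReal.ofReal ε := by
  obtain ⟨C₀, hC₀, hC⟩ := hmoments
  obtain ⟨κ, hκ, hlong⟩ := hlong
  have hXm : ∀ N, 1 ≤ N → ∀ t, Measurable (X N t) := fun N hN t =>
    ((hX N hN).adapted t).mono ((F N).le t) le_rfl
  have hpt : ∀ t, Tendsto (fun N => ∫⁻ ω, ParticleChaos.W2
      (ParticleChaos.empiricalMeasure (X N t ω)) (ρ t : Measure ℝ) ∂(P N)) atTop (𝓝 0) := fun t =>
    ParticleChaos.tendsto_lintegral_W2_of_weak (fun N hN => hXm N hN t) (hweak.2 t)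
      ENNReal.ofReal_ne_top fun N hN => by
        simp only [ParticleChaos.lintegral_empiricalMeasure_enorm_pow_four hN]
        exact hC N hN t
  -- The solution restarted at time `h` approaches the original one at the rate `exp (-κ s)`.
  have hdisp : ∀ (s h : ℝ≥0) (c : ℝ), 0 ≤ c → (∀ N : ℕ, 1 ≤ N →
      ∫⁻ ω, ENNReal.ofReal ((1 / (N : ℝ)) * ∑ i, |X N h ω i - X N 0 ω i| ^ 2) ∂(P N)
        ≤ ENNReal.ofReal (c ^ 2)) → ∀ N : ℕ, 1 ≤ N →
      ∫⁻ ω, ParticleChaos.W2 (ParticleChaos.empiricalMeasure (X N (h + s) ω))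
        (ρ (h + s) : Measure ℝ) ∂(P N) ≤
      ∫⁻ ω, ParticleChaos.W2 (ParticleChaos.empiricalMeasure (X N s ω)) (ρ s : Measure ℝ) ∂(P N)
        + 2 * ENNReal.ofReal (Real.exp (-κ * s) * c) := by
    intro s h c hc hw N hN
    refine ParticleChaos.lintegral_W2_le_add_displacement hXm hpt (fun M hM => ?_) hN
    have hshift := hlong M hM _ _ _ _ _ _ inferInstance inferInstance _ _ _ _ _ _ (hX M hM)
      ((hX M hM).shift h) s
    rw [add_zero] at hshift
    calc _ ≤ ((M : ℝ≥0∞)⁻¹) ^ (1 / 2 : ℝ) * (ENNReal.ofReal (Real.exp (-κ * s)) *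
          ParticleChaos.W2 ((P M).map (X M 0)) ((P M).map (X M h))) := by gcongr
      _ = ENNReal.ofReal (Real.exp (-κ * s)) * (((M : ℝ≥0∞)⁻¹) ^ (1 / 2 : ℝ) *
          ParticleChaos.W2 ((P M).map (X M 0)) ((P M).map (X M h))) := by ring
      _ ≤ ENNReal.ofReal (Real.exp (-κ * s)) * ENNReal.ofReal (c ^ 2) ^ (1 / 2 : ℝ) := by
          gcongr
          refine (ParticleChaos.inv_sqrt_mul_W2_map_le hM (hXm M hM 0) (hXm M hM h)).trans ?_
          gcongr
          exact hw M hM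
      _ = _ := by
          rw [ENNReal.ofReal_mul (Real.exp_nonneg _), ENNReal.ofReal_pow hc, ← ENNReal.rpow_two,
            ← ENNReal.rpow_mul]
          norm_num
  intro ε hε
  obtain ⟨δ, hδ, hδ'⟩ := hcont ((ε / 8) ^ 2) (by positivity)
  -- From the grid time `n δ` on, the exponential rate beats the bound on all displacements.
  obtain ⟨n, hn⟩ : ∃ n : ℕ, Real.exp (-κ * ((n * δ : ℝ≥0) : ℝ)) * √(4 + 4 * C₀) ≤ ε / 8 := by
    have h1 : Tendsto (fun n : ℕ => -(κ * δ) * (n : ℝ)) atTop atBot :=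
      tendsto_natCast_atTop_atTop.const_mul_atTop_of_neg
        (by have : (0 : ℝ) < δ := hδ
            simp only [Left.neg_neg_iff]; positivity)
    have h2 := (Real.tendsto_exp_atBot.comp h1).mul_const (√(4 + 4 * C₀))
    rw [zero_mul] at h2
    obtain ⟨n, hn⟩ := (h2.eventually_le_const (by positivity : 0 < ε / 8)).exists
    refine ⟨n, le_trans (le_of_eq ?_) hn⟩
    simp only [Function.comp_apply]
    congr 2
    push_cast
    ring
  have hgrid : ∀ᶠ N in atTop, ∀ k ∈ Finset.range (n + 1), ∫⁻ ω, ParticleChaos.W2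
      (ParticleChaos.empiricalMeasure (X N (k * δ) ω)) (ρ (k * δ) : Measure ℝ) ∂(P N)
        ≤ ENNReal.ofReal (ε / 4) := by
    rw [Finset.eventually_all]
    intro k _
    exact (hpt (k * δ)).eventually_le_const (ENNReal.ofReal_pos.2 (by positivity))
  obtain ⟨N₀, hN₀⟩ := eventually_atTop.1 hgrid
  -- Every time is at a controlled displacement from some grid time.
  have key : ∀ t : ℝ≥0, ∃ k ≤ n, ∃ (h : ℝ≥0) (c : ℝ), t = h + k * δ ∧ 0 ≤ c ∧
      (∀ N : ℕ, 1 ≤ N →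
        ∫⁻ ω, ENNReal.ofReal ((1 / (N : ℝ)) * ∑ i, |X N h ω i - X N 0 ω i| ^ 2) ∂(P N)
          ≤ ENNReal.ofReal (c ^ 2)) ∧
      Real.exp (-κ * ((k * δ : ℝ≥0) : ℝ)) * c ≤ ε / 8 := by
    intro t
    rcases le_or_gt (n * δ) t with ht | ht
    · refine ⟨n, le_rfl, t - n * δ, √(4 + 4 * C₀), (tsub_add_cancel_of_le ht).symm,
        Real.sqrt_nonneg _, fun N hN => ?_, hn⟩
      rw [Real.sq_sqrt (by positivity)]
      exact ParticleChaos.lintegral_mean_sq_sub_le hN (hXm N hN) hC₀ (hC N hN)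
    · have h1 : (⌊t / δ⌋₊ : ℝ≥0) * δ ≤ t :=
        (le_div_iff₀ hδ).1 (Nat.floor_le zero_le)
      have h2 : t < (⌊t / δ⌋₊ + 1) * δ := (div_lt_iff₀ hδ).1 (Nat.lt_floor_add_one _)
      refine ⟨⌊t / δ⌋₊, ?_, t - ⌊t / δ⌋₊ * δ, ε / 8, (tsub_add_cancel_of_le h1).symm,
        by positivity, fun N hN => hδ' _ ?_ N hN, ?_⟩
      · exact Nat.floor_le_of_le ((div_le_iff₀ hδ).2 ht.le)
      · rw [tsub_lt_iff_left h1]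
        linarith
      · refine mul_le_of_le_one_left (by positivity) (Real.exp_le_one_iff.2 ?_)
        have : (0 : ℝ) ≤ ((⌊t / δ⌋₊ * δ : ℝ≥0) : ℝ) := NNReal.coe_nonneg _
        nlinarith
  refine ⟨max N₀ 1, fun t N hN => ?_⟩
  obtain ⟨k, hk, h, c, rfl, hc, hw, hle⟩ := key t
  calc _ ≤ _ := hdisp (k * δ) h c hc hw N ((le_max_right _ _).trans hN)
    _ ≤ ENNReal.ofReal (ε / 4) + 2 * ENNReal.ofReal (ε / 8) := by
        gcongr
        exact hN₀ N ((le_max_left _ _).trans hN) k (Finset.mem_range.2 (by omega))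
    _ = ENNReal.ofReal (ε / 2) := by
        rw [← ENNReal.ofReal_ofNat 2, ← ENNReal.ofReal_mul (by norm_num),
          ← ENNReal.ofReal_add (by positivity) (by positivity)]
        congr 1
        ring
    _ < ENNReal.ofReal ε := (ENNReal.ofReal_lt_ofReal_iff hε).2 (by linarith)
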